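/- Consider an $M/GI/1/n$ queue ($n\ge 0$ is the buffer size excluding the customer in service) with Poisson input of rate $\lambda>0$ and service time distribution $$B(x)=pF(x)+(1-p)(1-e^{-\mu x}),\qquad 0<p\le 1,\ \mu>0,\ B(0)=0,$$ where $F$ is the distribution function of a nonnegative random variable $\zeta$ with mean $1/\mu$. Put $\overline F=1-F$, $E_\mu(x)=1-e^{-\mu x}$ and $F_y(x)=\Pr\{\zeta\le x+y\mid \zeta>y\}$ for $y\ge 0$ with $\overline F(y)>0$. Write $\Xi_1\le_{\mathscr C_\lambda}\Xi_2$ for distribution functions of nonnegative random variables if $\int_0^\infty e^{-\lambda x}x^i\,\Xi_1(x)\,dx\ge\int_0^\infty e^{-\lambda x}x^i\,\Xi_2(x)\,dx$ for all $i=0,1,2,\dots$ Let $\varepsilon>0$ and assume: (B) $\sup_{x,y\ge 0}|F_y(x)-F(x)|\le\varepsilon$, and $F$ is NBU ($\overline F(x+y)\le\overline F(x)\overline F(y)$ for all $x,y\ge0$) or NWU (the opposite inequality for all $x,y\ge 0$); (D) there is $y^0\ge 0$ with $F_{y^0}\le_{\mathscr C_\lambda}F_y$ for all $y\ge 0$.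 Put $\widehat B(\lambda)=p\int_0^\infty e^{-\lambda x}\,dF(x)+(1-p)\frac{\mu}{\mu+\lambda}$. **Theorem.** There is a Galton–Watson branching process $(Z_n)_{n\ge0}$, $Z_0=1$, whose offspring generating function $g$ satisfies $$g(z)<\frac{\widehat B(\lambda)}{1-z+z\widehat B(\lambda)}+3\varepsilon\cdot\frac{1-z+2z\widehat B(\lambda)}{1-z+z\widehat B(\lambda)},\qquad 0\le z\le 1,$$ and, for all complex $z$ with $|z|\le1$, $$\left|g(z)-\frac{\widehat B(\lambda)}{1-z+z\widehat B(\lambda)}\right|<3\varepsilon\cdot\frac{1-|z|+2|z|\widehat B(\lambda)}{1-|z|+|z|\widehat B(\lambda)},$$ such that the following holds for every $n\ge 0$. Let $L_n$ be the number of losses during a busy period of the queue, let $G$ be any probability distribution on $[0,\infty)$ with $G\le_{\mathscr C_\lambda}F_{y^0}$ and $G\le_{\mathscr C_\lambda}E_\mu$, and let $\varsigma_1,\varsigma_2,\dots$ be i.i.d., independent of $(Z_n)$, with $$\Pr\{\varsigma_i=m\}=\int_0^\infty e^{-\lambda x}\frac{(\lambda x)^m}{m!}\,dG(x),\qquad m=0,1,2,\dots$$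 Then $$L_n\ \ge_{st}\ \sum_{i=1}^{Z_n}\varsigma_i .$$ -/

import Mathlib

open MeasureTheory ProbabilityTheory Set
open scoped NNReal ENNReal

noncomputable section

namespace LossQueue

/-! ### Distributions on the half-line

A probability distribution function is represented by the corresponding measure on `ℝ`:
`F.real (Iic x)` is the value `F(x)` and `F.real (Ioi x)` is the tail `1 - F(x)`. -/

/-- The residual distribution `F_y(x) = Pr{ζ ≤ x + y | ζ > y}`, where `ζ` has law `F`
(meaningful when `Pr{ζ > y} > 0`). -/
def residual (F : Measure ℝ) (y : ℝ) : Measure ℝ :=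
  (ProbabilityTheory.cond F (Ioi y)).map (fun t => t - y)

/-- New Better than Used. -/
def IsNBU (F : Measure ℝ) : Prop :=
  ∀ x y : ℝ, 0 ≤ x → 0 ≤ y → F.real (Ioi (x + y)) ≤ F.real (Ioi x) * F.real (Ioi y)

/-- New Worse than Used. -/
def IsNWU (F : Measure ℝ) : Prop :=
  ∀ x y : ℝ, 0 ≤ x → 0 ≤ y → F.real (Ioi x) * F.real (Ioi y) ≤ F.real (Ioi (x + y))

/-- The order relation `Ξ₁ ≤ Ξ₂` in the sense of `𝒞_λ`. -/
def CLE (lam : ℝ) (Ξ₁ Ξ₂ : Measure ℝ) : Prop :=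
  ∀ i : ℕ, ∫ x in Ioi (0 : ℝ), Real.exp (-lam * x) * x ^ i * Ξ₂.real (Iic x) ≤
    ∫ x in Ioi (0 : ℝ), Real.exp (-lam * x) * x ^ i * Ξ₁.real (Iic x)

/-- The service time distribution `B = p F + (1 - p) E_μ`. -/
def serviceLaw (p mu : ℝ) (F : Measure ℝ) : Measure ℝ :=
  ENNReal.ofReal p • F + ENNReal.ofReal (1 - p) • expMeasure mu

/-- The Laplace–Stieltjes transform `p F̂(λ) + (1 - p) μ / (μ + λ)` of `B = p F + (1 - p) E_μ`
at the point `λ`. -/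
def serviceLST (lam p mu : ℝ) (F : Measure ℝ) : ℝ :=
  p * (∫ x, Real.exp (-lam * x) ∂F) + (1 - p) * (mu / (mu + lam))

/-- Condition (B) on the parameters `p`, `μ`, `ε` and on the distribution `F`. Since `p > 0`, the
standing assumption `B(0) = 0` together with nonnegativity says `F((-∞, 0]) = 0`. -/
structure ConditionB (p mu eps : ℝ) (F : Measure ℝ) : Prop where
  p_pos : 0 < p
  p_le_one : p ≤ 1
  mu_pos : 0 < mu
  eps_pos : 0 < eps
  prob : IsProbabilityMeasure F
  pos : F (Iic 0) = 0
  mean : ∫ x, x ∂F = 1 / mu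
  close : ∀ x y : ℝ, 0 ≤ x → 0 ≤ y → 0 < F (Ioi y) →
    |(residual F y).real (Iic x) - F.real (Iic x)| ≤ eps
  aging : IsNBU F ∨ IsNWU F

/-- `F_{y⁰}` is the least element, in the sense of `𝒞_λ`, of the family `F_y`, `y ≥ 0`; Condition
(D) says that such a `y⁰` exists. -/
structure IsLeastResidual (lam : ℝ) (F : Measure ℝ) (y₀ : ℝ) : Prop where
  nonneg : 0 ≤ y₀
  tail_pos : 0 < F (Ioi y₀)
  least : ∀ y : ℝ, 0 ≤ y → 0 < F (Ioi y) → CLE lam (residual F y₀) (residual F y)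

/-! ### The `M/GI/1/n` queue during a busy period -/

variable {Ω : Type*}

/-- A Poisson process of rate `lam`: a counting process with independent Poisson increments. -/
structure IsPoissonProcess [MeasurableSpace Ω] (P : Measure Ω) (lam : ℝ≥0)
    (N : ℝ≥0 → Ω → ℕ) : Prop where
  measurable : ∀ t, Measurable (N t)
  zero : ∀ ω, N 0 ω = 0
  mono : ∀ ω, Monotone (fun t => N t ω)
  right_continuous : ∀ ω t, ContinuousWithinAt (fun s => N s ω) (Ici t) t
  indep_increments : HasIndepIncrements N P
  increment_law : ∀ s t, s ≤ t →
    P.map (fun ω => N t ω - N s ω) = poissonMeasure (lam * (t - s))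

/-- The random input of an `M/GI/1` queue in which a customer arrives at time `0` and finds the
system empty: `N t` is the number of further arrivals in `(0, t]`, forming a Poisson process of
rate `lam`; the successive service times `χ 0, χ 1, …` are i.i.d. with law `B`; arrivals and
services are independent. -/
structure IsMGIInput [MeasurableSpace Ω] (P : Measure Ω) (lam : ℝ≥0) (B : Measure ℝ)
    (N : ℝ≥0 → Ω → ℕ) (χ : ℕ → Ω → ℝ) : Prop where
  arrivals : IsPoissonProcess P lam N
  measurable_service : ∀ i, Measurable (χ i)
  service_law : ∀ i, P.map (χ i) = B
  service_indep : iIndepFun χ P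
  indep : IndepFun (fun ω t => N t ω) (fun ω i => χ i ω) P

/-- The time at which the `k`-th service of the busy period is completed; `0` for `k = 0`. The
server never idles during a busy period, so this is also when the next service begins. -/
def epoch (χ : ℕ → Ω → ℝ) (k : ℕ) (ω : Ω) : ℝ≥0 :=
  (∑ i ∈ Finset.range k, χ i ω).toNNReal

/-- The number of arrivals during the service with index `k` (counted from `0`). -/
def arrivalsDuring (N : ℝ≥0 → Ω → ℕ) (χ : ℕ → Ω → ℝ) (ω : Ω) (k : ℕ) : ℕ :=
  N (epoch χ (k + 1) ω) ω - N (epoch χ k ω) ω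

/-- Effect of one arrival on (number of customers in the system, number of losses so far). There is
room for `n + 1` customers: one in service and `n` in the buffer. An arrival that finds the system
full is lost. -/
def arrivalStep (n : ℕ) (s : ℕ × ℕ) : ℕ × ℕ :=
  if s.1 = n + 1 then (s.1, s.2 + 1) else (s.1 + 1, s.2)

/-- One service during which `a` customers arrive, one after another, followed by the departure of
the served customer. Nothing happens once the busy period is over (no customer in the system). -/
def serviceStep (n : ℕ) (s : ℕ × ℕ) (a : ℕ) : ℕ × ℕ :=
  if s.1 = 0 then s else (((arrivalStep n)^[a] s).1 - 1, ((arrivalStep n)^[a] s).2)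

/-- (number in the system, losses so far) just after the `k`-th service completion, when `a i`
customers arrive during the service with index `i`. -/
def busyState (n : ℕ) (a : ℕ → ℕ) : ℕ → ℕ × ℕ
  | 0 => (1, 0)
  | k + 1 => serviceStep n (busyState n a k) (a k)

/-- `L_n`, the total number of losses during the busy period. -/
def losses (n : ℕ) (N : ℝ≥0 → Ω → ℕ) (χ : ℕ → Ω → ℝ) (ω : Ω) : ℕ∞ :=
  ⨆ k, ((busyState n (arrivalsDuring N χ ω) k).2 : ℕ∞)

/-! ### Galton–Watson processes -/

/-- The law of the sum of `k` independent random variables with law `ν`. -/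
def iidSum (ν : PMF ℕ) : ℕ → PMF ℕ
  | 0 => PMF.pure 0
  | k + 1 => (iidSum ν k).bind fun s => ν.map fun x => s + x

/-- The law of the `n`-th generation `Z_n` of the Galton–Watson process with `Z_0 = 1` and
offspring law `ν`. -/
def galtonWatson (ν : PMF ℕ) : ℕ → PMF ℕ
  | 0 => PMF.pure 1
  | n + 1 => (galtonWatson ν n).bind (iidSum ν)

/-- The law of `∑_{i=1}^{Z} ς_i`, where `Z` has law `ζ` and the `ς_i` are i.i.d. with law `ς`,
independent of `Z`. -/
def randomSum (ζ ς : PMF ℕ) : PMF ℕ := ζ.bind (iidSum ς)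

/-- The probability generating function of `ν`, at real or complex points. -/
def pgf {𝕜 : Type*} [RCLike 𝕜] (ν : PMF ℕ) (z : 𝕜) : 𝕜 :=
  ∑' m : ℕ, ((ν m).toReal : 𝕜) * z ^ m

/-- The random variable `X` is stochastically at least as large as one with law `ν`. -/
def StGE [MeasurableSpace Ω] (P : Measure Ω) (X : Ω → ℕ∞) (ν : PMF ℕ) : Prop :=
  ∀ m : ℕ, ν.toMeasure (Ici m) ≤ P {ω | (m : ℕ∞) ≤ X ω}

end LossQueue

end

/-! Let β be the law of the number of arrivals during one service and b = β{0}, which equals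
`serviceLST`. Two properties of β carry the argument. Once i arrivals have occurred in a service,
the number of further ones dominates the law of ς (`arrivalLaw_serviceLaw_Ici_mul_le`), and it
vanishes with conditional probability at most r = `emptyProb`
(`arrivalLaw_serviceLaw_singleton_le`). Both follow by conditioning on the epoch y of the i-th
arrival: the rest of the service has law F_y or, by lack of memory, E_μ in the two components of B.
The order 𝒞_λ compares tails of Poisson counts over such times, its weights being Erlang densities
up to constants.

Consider a service starting with room for k + 1 customers. With probability b it ends without
arrivals. Otherwise an arrival leaves room for k; when room for k + 1 is regained a new service
starts and the trial repeats. These upcrossings are thus geometric in number, with law γ of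
parameter b. Just after an arrival in mid-service only the first trial differs: it fails with
probability at most r. So each upcrossing produces at the next level at least ν many, where ν is 0
with probability r and 1 + γ otherwise. Levels of the buffer are generations, and an upcrossing that
fills the system loses all further arrivals of that service, at least ς many. The induction over
levels is `measure_Ici_mul_expect_iterate_le`. The busy period begins with a fresh service, which
only helps because b ≤ r (`expect_iterate_le_freshLaw`).

The bound reaches the losses because `value` is a submartingale along the queue and the busy period
ends geometrically fast. Finally γ has generating function b / (1 - z + zb), that of ν differs from
it by (r - b)(1 - z) / (1 - z + zb), and r - b < 3ε since the transform of F is within ε of those of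
F_y and of E_μ (`ConditionB.abs_residual_sub_le`, `ConditionB.abs_sub_exp_le`). -/

namespace LossQueue

open Filter Topology

variable {Ω : Type*}

/-! ### The number of Poisson arrivals during a random time -/

lemma measurable_poissonMeasure_apply (s : Set ℕ) :
    Measurable fun r : ℝ≥0 => poissonMeasure r s := by
  have h : ∀ r : ℝ≥0, poissonMeasure r s = ∑' n : ℕ,
      ENNReal.ofReal (Real.exp (-r) * r ^ n / n.factorial) * Measure.dirac n s := fun r => by
    rw [poissonMeasure, Measure.sum_apply _ (MeasurableSet.of_discrete)]
    simp
  simp_rw [h]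
  exact Measurable.tsum fun n => by fun_prop

lemma measurable_poissonMeasure : Measurable poissonMeasure :=
  Measure.measurable_of_measurable_coe _ fun s _ => measurable_poissonMeasure_apply s

/-- The law of the number of arrivals of a Poisson process of rate `lam` during an independent
time with law `F`. -/
noncomputable def arrivalLaw (lam : ℝ≥0) (F : Measure ℝ) : Measure ℕ :=
  F.bind fun x => poissonMeasure (lam * x.toNNReal)

lemma measurable_poissonMeasure_mul (lam : ℝ≥0) :
    Measurable fun x : ℝ => poissonMeasure (lam * x.toNNReal) :=
  measurable_poissonMeasure.comp (by fun_prop)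

lemma arrivalLaw_apply (lam : ℝ≥0) (F : Measure ℝ) (s : Set ℕ) :
    arrivalLaw lam F s = ∫⁻ x, poissonMeasure (lam * x.toNNReal) s ∂F :=
  Measure.bind_apply .of_discrete (measurable_poissonMeasure_mul lam).aemeasurable

instance (lam : ℝ≥0) (F : Measure ℝ) [IsProbabilityMeasure F] :
    IsProbabilityMeasure (arrivalLaw lam F) := ⟨by simp [arrivalLaw_apply]⟩

/-- The density of the `(k + 1)`-st arrival time of a Poisson process of rate `lam`. -/
noncomputable def erlangPDFReal (lam : ℝ≥0) (k : ℕ) (t : ℝ) : ℝ :=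
  lam * (Real.exp (-lam * t) * (lam * t) ^ k / k.factorial)

lemma erlangPDFReal_nonneg (lam : ℝ≥0) (k : ℕ) {t : ℝ} (ht : 0 ≤ t) :
    0 ≤ erlangPDFReal lam k t := by
  unfold erlangPDFReal; positivity

lemma continuous_erlangPDFReal (lam : ℝ≥0) (k : ℕ) : Continuous (erlangPDFReal lam k) := by
  unfold erlangPDFReal; fun_prop

/-- Each Poisson weight has as derivative a difference of consecutive weights, so the sum
telescopes. -/
lemma hasDerivAt_poisson_partial_sum (lam : ℝ≥0) (k : ℕ) (t : ℝ) :
    HasDerivAt (fun t : ℝ => -∑ j ∈ Finset.range (k + 1),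
      Real.exp (-lam * t) * (lam * t) ^ j / j.factorial) (erlangPDFReal lam k t) t := by
  have hexp : HasDerivAt (fun t : ℝ => Real.exp (-lam * t)) (-lam * Real.exp (-lam * t)) t := by
    have := ((hasDerivAt_id t).const_mul (-(lam : ℝ))).exp
    simpa [mul_comm] using this
  have hlin : HasDerivAt (fun t : ℝ => (lam : ℝ) * t) lam t := by
    simpa using (hasDerivAt_id t).const_mul (lam : ℝ)
  induction k with
  | zero =>
    refine (hexp.neg.congr_deriv ?_).congr_of_eventuallyEq (.of_forall fun s => ?_) <;>
      simp [erlangPDFReal]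
  | succ k ih =>
    have h2 := (hexp.mul (hlin.pow (k + 1))).div_const ((k + 1).factorial : ℝ)
    have h := ih.sub h2
    refine (h.congr_deriv ?_).congr_of_eventuallyEq (.of_forall fun s => ?_)
    · simp only [erlangPDFReal, Nat.factorial_succ, Nat.cast_mul, Nat.cast_add, Nat.cast_one,
        Nat.add_sub_cancel]
      have : ((k : ℝ) + 1) ≠ 0 := by positivity
      have : (k.factorial : ℝ) ≠ 0 := by positivity
      field_simp
      simp
    · simp only [Finset.sum_range_succ _ (k + 1), Pi.sub_apply]
      simp
      ring

/-- At least k + 1 arrivals occur by time x exactly when the (k + 1)-st arrival epoch comes before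
x. -/
lemma poissonMeasure_Ici_succ (lam : ℝ≥0) (k : ℕ) (x : ℝ) :
    poissonMeasure (lam * x.toNNReal) (Ici (k + 1)) =
      ∫⁻ t in Ioo 0 x, ENNReal.ofReal (erlangPDFReal lam k t) := by
  rcases le_or_gt x 0 with hx | hx
  · rw [Ioo_eq_empty (by simpa using hx), Real.toNNReal_of_nonpos hx]
    have : poissonMeasure (lam * 0) (Iic k)ᶜ = 0 := by
      rw [prob_compl_eq_zero_iff (.of_discrete)]
      refine le_antisymm prob_le_one ?_
      calc (1 : ℝ≥0∞) = poissonMeasure (lam * 0) {0} := by simp [poissonMeasure_singleton]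
        _ ≤ _ := measure_mono (by simp)
    have hs : Ici (k + 1) = (Iic k)ᶜ := by ext; simp
    simpa [hs] using this
  · have hs : Ici (k + 1) = ((Finset.range (k + 1) : Finset ℕ) : Set ℕ)ᶜ := by ext; simp
    have hfin : (poissonMeasure (lam * x.toNNReal)).real (Finset.range (k + 1) : Finset ℕ) =
        ∑ j ∈ Finset.range (k + 1), Real.exp (-lam * x) * (lam * x) ^ j / j.factorial := by
      rw [← sum_measureReal_singleton]
      refine Finset.sum_congr rfl fun j _ => ?_
      rw [poissonMeasure_real_singleton]
      simp [hx.le]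
    have hint : IntervalIntegrable (erlangPDFReal lam k) volume 0 x :=
      (continuous_erlangPDFReal lam k).intervalIntegrable _ _
    have hftc := intervalIntegral.integral_eq_sub_of_hasDerivAt
      (fun t _ => hasDerivAt_poisson_partial_sum lam k t) hint
    rw [intervalIntegral.integral_of_le hx.le, integral_Ioc_eq_integral_Ioo] at hftc
    rw [← ofReal_integral_eq_lintegral_ofReal, hftc, hs, ← ofReal_measureReal,
      probReal_compl_eq_one_sub (.of_discrete), hfin]
    · congr 1
      have h0 : ∑ j ∈ Finset.range (k + 1),
          Real.exp (-lam * 0) * ((lam : ℝ) * 0) ^ j / j.factorial = 1 := by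
        rw [Finset.sum_range_succ' _ k]
        simp
      rw [h0]
      ring
    · exact ((intervalIntegrable_iff_integrableOn_Ioo_of_le hx.le).1 hint)
    · exact (ae_restrict_iff' measurableSet_Ioo).2
        (.of_forall fun t ht => erlangPDFReal_nonneg lam k ht.1.le)

/-- The Beta integral: y^(a+1) (t-y)^(b+1) vanishes at both ends, so its derivative trades a power
of t - y for one of y. -/
lemma integral_pow_mul_sub_pow (a b : ℕ) (t : ℝ) :
    ∫ y in (0 : ℝ)..t, y ^ a * (t - y) ^ b =
      a.factorial * b.factorial / (a + b + 1).factorial * t ^ (a + b + 1) := by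
  induction b generalizing a with
  | zero =>
    simp only [pow_zero, mul_one, integral_pow, add_zero, Nat.factorial_succ]
    have : (a.factorial : ℝ) ≠ 0 := by positivity
    have : ((a : ℝ) + 1) ≠ 0 := by positivity
    push_cast
    field_simp
    simp
  | succ b ih =>
    have hd : ∀ y : ℝ, HasDerivAt (fun y : ℝ => y ^ (a + 1) * (t - y) ^ (b + 1))
        ((a + 1) * (y ^ a * (t - y) ^ (b + 1)) - (b + 1) * (y ^ (a + 1) * (t - y) ^ b)) y := by
      intro y
      have := (hasDerivAt_pow (a + 1) y).mul (((hasDerivAt_id y).const_sub t).pow (b + 1))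
      refine this.congr_deriv ?_
      simp
      ring
    have h := intervalIntegral.integral_eq_sub_of_hasDerivAt (a := 0) (b := t)
      (fun y _ => hd y) (Continuous.intervalIntegrable (by fun_prop) _ _)
    rw [intervalIntegral.integral_sub (Continuous.intervalIntegrable (by fun_prop) _ _)
      (Continuous.intervalIntegrable (by fun_prop) _ _), intervalIntegral.integral_const_mul,
      intervalIntegral.integral_const_mul, ih (a + 1)] at h
    have e : a + 1 + b + 1 = a + (b + 1) + 1 := by ring
    simp only [e, sub_self, zero_pow (Nat.succ_ne_zero _), mul_zero, zero_mul] at h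
    have : ((a : ℝ) + 1) ≠ 0 := by positivity
    have hf : ((a + (b + 1) + 1).factorial : ℝ) ≠ 0 := by positivity
    rw [Nat.factorial_succ a] at h
    rw [Nat.factorial_succ b]
    push_cast at h ⊢
    apply mul_left_cancel₀ this
    rw [sub_eq_zero.1 h]
    ring

/-- Index k stands for the (k + 1)-st epoch; adding i + 1 and m + 1 interarrival times gives epoch i
+ m + 2, hence index i + m + 1. -/
lemma lintegral_erlangPDF_conv (lam : ℝ≥0) (i m : ℕ) {t : ℝ} (ht : 0 < t) :
    ∫⁻ y in Ioo 0 t, ENNReal.ofReal (erlangPDFReal lam i y) *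
      ENNReal.ofReal (erlangPDFReal lam m (t - y)) =
      ENNReal.ofReal (erlangPDFReal lam (i + m + 1) t) := by
  have hc : Continuous fun y => erlangPDFReal lam i y * erlangPDFReal lam m (t - y) :=
    (continuous_erlangPDFReal lam i).mul ((continuous_erlangPDFReal lam m).comp (by fun_prop))
  have h1 : ∫⁻ y in Ioo 0 t, ENNReal.ofReal (erlangPDFReal lam i y) *
      ENNReal.ofReal (erlangPDFReal lam m (t - y)) =
      ∫⁻ y in Ioo 0 t, ENNReal.ofReal (erlangPDFReal lam i y * erlangPDFReal lam m (t - y)) :=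
    setLIntegral_congr_fun measurableSet_Ioo fun y hy =>
      (ENNReal.ofReal_mul (erlangPDFReal_nonneg lam i hy.1.le)).symm
  rw [h1, ← ofReal_integral_eq_lintegral_ofReal]
  · congr 1
    rw [← integral_Ioc_eq_integral_Ioo, ← intervalIntegral.integral_of_le ht.le]
    have h2 : ∀ y, erlangPDFReal lam i y * erlangPDFReal lam m (t - y) =
        lam ^ (i + m + 2) * Real.exp (-lam * t) / (i.factorial * m.factorial) *
          (y ^ i * (t - y) ^ m) := by
      intro y
      have : Real.exp (-lam * t) = Real.exp (-lam * y) * Real.exp (-lam * (t - y)) := by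
        rw [← Real.exp_add]; ring_nf
      rw [this]
      simp only [erlangPDFReal, mul_pow]
      ring
    simp_rw [h2]
    rw [intervalIntegral.integral_const_mul, integral_pow_mul_sub_pow, erlangPDFReal, mul_pow]
    have : (i.factorial : ℝ) ≠ 0 := by positivity
    have : (m.factorial : ℝ) ≠ 0 := by positivity
    field_simp
    ring
  · exact ((intervalIntegrable_iff_integrableOn_Ioo_of_le ht.le).1 (hc.intervalIntegrable _ _))
  · exact (ae_restrict_iff' measurableSet_Ioo).2 (.of_forall fun y hy => mul_nonneg
      (erlangPDFReal_nonneg lam i hy.1.le) (erlangPDFReal_nonneg lam m (sub_pos.2 hy.2).le))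

/-- The Erlang density, with values in `ℝ≥0∞` and extended by zero to the whole line. -/
noncomputable def erlangPDF (lam : ℝ≥0) (k : ℕ) : ℝ → ℝ≥0∞ :=
  (Ioi 0).indicator fun t => ENNReal.ofReal (erlangPDFReal lam k t)

lemma measurable_erlangPDF (lam : ℝ≥0) (k : ℕ) : Measurable (erlangPDF lam k) :=
  (continuous_erlangPDFReal lam k).measurable.ennreal_ofReal.indicator measurableSet_Ioi

lemma lintegral_erlangPDF_conv_univ (lam : ℝ≥0) (i m : ℕ) (t : ℝ) :
    ∫⁻ y, erlangPDF lam i y * erlangPDF lam m (t - y) = erlangPDF lam (i + m + 1) t := by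
  have h : ∀ y, erlangPDF lam i y * erlangPDF lam m (t - y) = (Ioo 0 t).indicator (fun y =>
      ENNReal.ofReal (erlangPDFReal lam i y) * ENNReal.ofReal (erlangPDFReal lam m (t - y))) y := by
    intro y
    by_cases h1 : 0 < y <;> by_cases h2 : y < t <;> simp [erlangPDF, indicator, h1, h2]
  simp_rw [h]
  rw [lintegral_indicator measurableSet_Ioo]
  rcases le_or_gt t 0 with ht | ht
  · simp [erlangPDF, indicator, Ioo_eq_empty, ht.not_gt]
  · rw [lintegral_erlangPDF_conv lam i m ht]
    simp [erlangPDF, indicator, ht]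

lemma measurable_measure_Ioi (F : Measure ℝ) : Measurable fun t : ℝ => F (Ioi t) :=
  Antitone.measurable fun _ _ h => measure_mono (Ioi_subset_Ioi h)

lemma arrivalLaw_Ici_succ (lam : ℝ≥0) (F : Measure ℝ) [SFinite F] (k : ℕ) :
    arrivalLaw lam F (Ici (k + 1)) = ∫⁻ t, erlangPDF lam k t * F (Ioi t) := by
  have h : ∀ x : ℝ, poissonMeasure (lam * x.toNNReal) (Ici (k + 1)) =
      ∫⁻ t, erlangPDF lam k t * (Ioi t).indicator 1 x := by
    intro x
    rw [poissonMeasure_Ici_succ, ← lintegral_indicator measurableSet_Ioo]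
    congr 1 with t
    by_cases h1 : 0 < t <;> by_cases h2 : t < x <;> simp [erlangPDF, indicator, h1, h2]
  have hm : Measurable fun z : ℝ × ℝ => erlangPDF lam k z.2 * (Ioi z.2).indicator 1 z.1 := by
    refine ((measurable_erlangPDF lam k).comp measurable_snd).mul ?_
    have : (fun z : ℝ × ℝ => (Ioi z.2).indicator (1 : ℝ → ℝ≥0∞) z.1) =
        {z : ℝ × ℝ | z.2 < z.1}.indicator 1 := by
      ext z; simp [indicator]
    rw [this]
    exact measurable_one.indicator (measurableSet_lt measurable_snd measurable_fst)
  rw [arrivalLaw_apply]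
  simp_rw [h]
  rw [lintegral_lintegral_swap hm.aemeasurable]
  congr 1 with t
  rw [lintegral_const_mul _ (measurable_one.indicator measurableSet_Ioi)]
  simp [measurableSet_Ioi]

/-- Conditioning on the epoch y of the (i + 1)-st arrival: the service must outlast y by the further
time x of m + 1 more arrivals. -/
lemma arrivalLaw_Ici_add (lam : ℝ≥0) (F : Measure ℝ) [SFinite F] (i m : ℕ) :
    arrivalLaw lam F (Ici (i + 1 + (m + 1))) =
      ∫⁻ y, erlangPDF lam i y * ∫⁻ x, erlangPDF lam m x * F (Ioi (x + y)) := by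
  have e : i + 1 + (m + 1) = i + m + 1 + 1 := by ring
  have hF := measurable_measure_Ioi F
  have hi := measurable_erlangPDF lam i
  have hm := measurable_erlangPDF lam m
  rw [e, arrivalLaw_Ici_succ]
  simp_rw [← lintegral_erlangPDF_conv_univ]
  have h1 : ∀ t, (∫⁻ y, erlangPDF lam i y * erlangPDF lam m (t - y)) * F (Ioi t) =
      ∫⁻ y, erlangPDF lam i y * erlangPDF lam m (t - y) * F (Ioi t) := fun t =>
    (lintegral_mul_const _ (hi.mul (hm.comp (by fun_prop)))).symm
  simp_rw [h1]
  rw [lintegral_lintegral_swap]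
  · congr 1 with y
    have h2 : Measurable fun t => erlangPDF lam m (t - y) * F (Ioi t) :=
      (hm.comp (by fun_prop)).mul hF
    simp_rw [mul_assoc]
    rw [lintegral_const_mul _ h2, ← lintegral_add_right_eq_self _ y]
    simp
  · exact (((hi.comp measurable_snd).mul (hm.comp (by fun_prop))).mul
      (hF.comp measurable_fst)).aemeasurable

/-! ### Residual distributions -/

lemma residual_Ioi (F : Measure ℝ) {x y : ℝ} (hx : 0 ≤ x) :
    residual F y (Ioi x) = (F (Ioi y))⁻¹ * F (Ioi (x + y)) := by
  have h : (fun t : ℝ => t - y) ⁻¹' Ioi x = Ioi (x + y) := by ext; simp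
  rw [residual, Measure.map_apply (by fun_prop) measurableSet_Ioi, h,
    cond_apply measurableSet_Ioi, Ioi_inter_Ioi, sup_eq_right.2 (by linarith)]

lemma isProbabilityMeasure_residual (F : Measure ℝ) [IsFiniteMeasure F] {y : ℝ}
    (hy : 0 < F (Ioi y)) : IsProbabilityMeasure (residual F y) :=
  have := cond_isProbabilityMeasure hy.ne'
  Measure.isProbabilityMeasure_map (by fun_prop)

lemma residual_zero (F : Measure ℝ) [IsProbabilityMeasure F] (h0 : F (Iic 0) = 0) :
    residual F 0 = F := by
  have h1 : F (Ioi 0) = 1 := by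
    rw [← compl_Iic, prob_compl_eq_one_iff measurableSet_Iic]
    exact h0
  have h2 : ∀ᵐ x ∂F, x ∈ Ioi (0 : ℝ) := by
    rw [ae_iff]
    simpa [← Iic_def] using h0
  simp [residual, ProbabilityTheory.cond, h1, Measure.restrict_eq_self_of_ae_mem h2]

lemma measure_Ioi_add (F : Measure ℝ) [IsFiniteMeasure F] {x y : ℝ} (hx : 0 ≤ x)
    (hy : 0 < F (Ioi y)) : F (Ioi (x + y)) = F (Ioi y) * residual F y (Ioi x) := by
  rw [residual_Ioi F hx, ← mul_assoc, ENNReal.mul_inv_cancel hy.ne' (measure_ne_top _ _), one_mul]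

lemma measurable_erlangPDF_mul_Ioi (lam : ℝ≥0) (k : ℕ) (F : Measure ℝ) :
    Measurable fun t => erlangPDF lam k t * F (Ioi t) :=
  (measurable_erlangPDF lam k).mul (measurable_measure_Ioi F)

/-! ### Comparison of the numbers of arrivals -/

lemma integrableOn_exp_mul_pow {lam : ℝ} (hlam : 0 < lam) (m : ℕ) :
    IntegrableOn (fun x => Real.exp (-lam * x) * x ^ m) (Ioi 0) := by
  have := integrableOn_rpow_mul_exp_neg_mul_rpow (s := m) (p := 1) (b := lam)
    (by have : (0 : ℝ) ≤ m := m.cast_nonneg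
        linarith) one_pos hlam
  refine this.congr_fun (fun x _ => ?_) measurableSet_Ioi
  simp [mul_comm]

lemma integrableOn_exp_mul_pow_mul_Iic {lam : ℝ} (hlam : 0 < lam) (m : ℕ) (Ξ : Measure ℝ)
    [IsProbabilityMeasure Ξ] :
    IntegrableOn (fun x => Real.exp (-lam * x) * x ^ m * Ξ.real (Iic x)) (Ioi 0) := by
  refine (integrableOn_exp_mul_pow hlam m).mul_bdd (c := 1) ?_ (.of_forall fun x => ?_)
  · have : Monotone fun x => Ξ.real (Iic x) := fun _ _ h => measureReal_mono (Iic_subset_Iic.2 h)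
    exact this.measurable.aestronglyMeasurable
  · rw [Real.norm_of_nonneg measureReal_nonneg]
    exact measureReal_le_one

/-- The weights e^(-λx) x^m of 𝒞_λ are Erlang densities up to λ^(m+1)/m!. Passing from distribution
function to tail reverses the inequality, so 𝒞_λ orders the arrival counts. -/
lemma lintegral_erlangPDF_mul_Ioi {lam : ℝ≥0} (hlam : 0 < lam) (m : ℕ) (Ξ : Measure ℝ)
    [IsProbabilityMeasure Ξ] :
    ∫⁻ x, erlangPDF lam m x * Ξ (Ioi x) = ENNReal.ofReal (lam ^ (m + 1) / m.factorial *
      ((∫ x in Ioi (0 : ℝ), Real.exp (-lam * x) * x ^ m) -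
        ∫ x in Ioi (0 : ℝ), Real.exp (-lam * x) * x ^ m * Ξ.real (Iic x))) := by
  have h1 := integrableOn_exp_mul_pow (NNReal.coe_pos.2 hlam) m
  have h2 := integrableOn_exp_mul_pow_mul_Iic (NNReal.coe_pos.2 hlam) m Ξ
  rw [← integral_sub h1 h2, ← integral_const_mul, ofReal_integral_eq_lintegral_ofReal,
    ← lintegral_indicator measurableSet_Ioi]
  · congr 1 with x
    by_cases hx : 0 < x
    · have hc : Ξ (Ioi x) = ENNReal.ofReal (1 - Ξ.real (Iic x)) := by
        rw [← probReal_compl_eq_one_sub measurableSet_Iic, compl_Iic, ofReal_measureReal]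
      simp only [erlangPDF, indicator, mem_Ioi, hx, if_true, hc]
      rw [← ENNReal.ofReal_mul (erlangPDFReal_nonneg lam m hx.le), erlangPDFReal]
      congr 1
      ring
    · simp [erlangPDF, indicator, hx]
  · exact (h1.sub h2).const_mul _
  · refine (ae_restrict_iff' measurableSet_Ioi).2 (.of_forall fun x hx => ?_)
    have hx' : (0 : ℝ) < x := hx
    have : 0 ≤ 1 - Ξ.real (Iic x) := sub_nonneg.2 measureReal_le_one
    have : 0 ≤ lam ^ (m + 1) / m.factorial *
      (Real.exp (-lam * x) * x ^ m * (1 - Ξ.real (Iic x))) := by positivity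
    simpa [mul_sub] using this

lemma CLE.lintegral_erlangPDF_le {lam : ℝ≥0} (hlam : 0 < lam) {G Ξ : Measure ℝ}
    [IsProbabilityMeasure G] [IsProbabilityMeasure Ξ] (h : CLE lam G Ξ) (m : ℕ) :
    ∫⁻ x, erlangPDF lam m x * G (Ioi x) ≤ ∫⁻ x, erlangPDF lam m x * Ξ (Ioi x) := by
  rw [lintegral_erlangPDF_mul_Ioi hlam, lintegral_erlangPDF_mul_Ioi hlam]
  refine ENNReal.ofReal_le_ofReal (mul_le_mul_of_nonneg_left ?_ (by positivity))
  have := h m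
  linarith

lemma CLE.trans {lam : ℝ} {Ξ₁ Ξ₂ Ξ₃ : Measure ℝ} (h₁ : CLE lam Ξ₁ Ξ₂) (h₂ : CLE lam Ξ₂ Ξ₃) :
    CLE lam Ξ₁ Ξ₃ := fun i => (h₂ i).trans (h₁ i)

lemma CLE.refl (lam : ℝ) (Ξ : Measure ℝ) : CLE lam Ξ Ξ := fun _ => le_rfl

/-- Given that the i-th arrival comes at y during the service, what remains has law F_y and brings
at least as many arrivals as a time with law G. For i = 0 the age is zero and F_0 = F. -/
lemma arrivalLaw_Ici_mul_le {lam : ℝ≥0} (hlam : 0 < lam) (F G : Measure ℝ)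
    [IsProbabilityMeasure F] [IsProbabilityMeasure G] (h0 : F (Iic 0) = 0)
    (h : ∀ y : ℝ, 0 ≤ y → 0 < F (Ioi y) → CLE lam G (residual F y)) (i m : ℕ) :
    arrivalLaw lam F (Ici i) * arrivalLaw lam G (Ici m) ≤ arrivalLaw lam F (Ici (i + m)) := by
  have huniv : (Ici 0 : Set ℕ) = univ := by ext; simp
  rcases m with _ | m
  · simp [huniv]
  rcases i with _ | i
  · have hF : F (Ioi 0) = 1 := by
      rw [← compl_Iic, prob_compl_eq_one_iff measurableSet_Iic]
      exact h0
    have := h 0 le_rfl (by simp [hF])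
    rw [residual_zero F h0] at this
    rw [huniv, measure_univ, one_mul, zero_add, arrivalLaw_Ici_succ, arrivalLaw_Ici_succ]
    exact this.lintegral_erlangPDF_le hlam m
  · rw [arrivalLaw_Ici_add, arrivalLaw_Ici_succ, arrivalLaw_Ici_succ,
      ← lintegral_mul_const _ (measurable_erlangPDF_mul_Ioi lam i F)]
    refine lintegral_mono fun y => ?_
    rw [mul_assoc]
    by_cases hy : 0 < y
    · rcases eq_or_ne (F (Ioi y)) 0 with hF | hF
      · simp [hF]
      have hF := pos_iff_ne_zero.2 hF
      have := isProbabilityMeasure_residual F hF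
      gcongr
      calc F (Ioi y) * ∫⁻ x, erlangPDF lam m x * G (Ioi x)
          ≤ F (Ioi y) * ∫⁻ x, erlangPDF lam m x * residual F y (Ioi x) := by
            exact mul_le_mul' le_rfl ((h y hy.le hF).lintegral_erlangPDF_le hlam m)
        _ = ∫⁻ x, F (Ioi y) * (erlangPDF lam m x * residual F y (Ioi x)) :=
            (lintegral_const_mul _ (measurable_erlangPDF_mul_Ioi lam m _)).symm
        _ = ∫⁻ x, erlangPDF lam m x * F (Ioi (x + y)) := by
            congr 1 with x
            by_cases hx : 0 < x
            · rw [measure_Ioi_add F hx.le hF]; ring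
            · simp [erlangPDF, indicator, hx]
    · simp [erlangPDF, indicator, hy]

lemma toReal_arrivalLaw_singleton (lam : ℝ≥0) (F : Measure ℝ) [IsProbabilityMeasure F]
    (h0 : F (Iio 0) = 0) (m : ℕ) :
    (arrivalLaw lam F {m}).toReal =
      ∫ x, Real.exp (-lam * x) * ((lam * x) ^ m / (m.factorial : ℝ)) ∂F := by
  have hpos : ∀ᵐ x ∂F, (0 : ℝ) ≤ x := by
    rw [ae_iff]
    simpa [← Iio_def] using h0
  rw [arrivalLaw_apply, integral_eq_lintegral_of_nonneg_ae]
  · congr 1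
    refine lintegral_congr_ae ?_
    filter_upwards [hpos] with x hx
    rw [poissonMeasure_singleton]
    simp [hx, mul_div_assoc]
  · filter_upwards [hpos] with x hx
    positivity
  · exact Measurable.aestronglyMeasurable (by fun_prop)

lemma measure_Ici_eq_add (β : Measure ℕ) (i : ℕ) : β {i} + β (Ici (i + 1)) = β (Ici i) := by
  rw [← measure_union _ .of_discrete]
  · congr 1
    ext; simp; omega
  · simp

/-! ### The Laplace–Stieltjes transform at `lam` -/

lemma lintegral_erlangPDF_zero {lam : ℝ≥0} (hlam : 0 < lam) : ∫⁻ t, erlangPDF lam 0 t = 1 := by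
  rw [← lintegral_exponentialPDF_eq_one (NNReal.coe_pos.2 hlam)]
  refine lintegral_congr_ae ?_
  have : ∀ᵐ x : ℝ, x ≠ 0 := by simp [ae_iff]
  filter_upwards [this] with x hx
  rw [exponentialPDF_eq]
  rcases lt_or_gt_of_ne hx with h | h
  · simp [erlangPDF, indicator, h.not_gt, h.not_ge]
  · simp [erlangPDF, erlangPDFReal, indicator, h, h.le]

lemma expMeasure_Ioi {mu : ℝ} (hmu : 0 < mu) {x : ℝ} (hx : 0 ≤ x) :
    expMeasure mu (Ioi x) = ENNReal.ofReal (Real.exp (-(mu * x))) := by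
  have := isProbabilityMeasure_expMeasure hmu
  have h := cdf_expMeasure_eq hmu x
  rw [cdf_eq_real, if_pos hx] at h
  rw [← compl_Iic, ← ofReal_measureReal, probReal_compl_eq_one_sub measurableSet_Iic, h]
  congr 1
  ring

lemma expMeasure_Iic_zero {mu : ℝ} (hmu : 0 < mu) : expMeasure mu (Iic 0) = 0 := by
  have := isProbabilityMeasure_expMeasure hmu
  have h := expMeasure_Ioi hmu le_rfl
  rw [← compl_Iic] at h
  exact (prob_compl_eq_one_iff measurableSet_Iic).1 (by simpa using h)

/-- Lack of memory: the residual law has the same distribution function at every x > 0, and `CLE`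
integrates over these points only. -/
lemma CLE.residual_expMeasure {lam mu : ℝ} (hmu : 0 < mu) {G : Measure ℝ}
    (h : CLE lam G (expMeasure mu)) {y : ℝ} (hy : 0 ≤ y) :
    CLE lam G (residual (expMeasure mu) y) := by
  have := isProbabilityMeasure_expMeasure hmu
  have hpos : 0 < expMeasure mu (Ioi y) := by
    rw [expMeasure_Ioi hmu hy]
    exact ENNReal.ofReal_pos.2 (Real.exp_pos _)
  have := isProbabilityMeasure_residual _ hpos
  have key : ∀ x : ℝ, 0 < x →
      (residual (expMeasure mu) y).real (Iic x) = (expMeasure mu).real (Iic x) := by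
    intro x hx
    have e : residual (expMeasure mu) y (Ioi x) = expMeasure mu (Ioi x) := by
      rw [residual_Ioi _ hx.le, ← ENNReal.div_eq_inv_mul, eq_comm,
        ENNReal.eq_div_iff hpos.ne' (measure_ne_top _ _), expMeasure_Ioi hmu hy,
        expMeasure_Ioi hmu hx.le, expMeasure_Ioi hmu (add_nonneg hx.le hy),
        ← ENNReal.ofReal_mul (Real.exp_nonneg _),
        ← Real.exp_add]
      congr 2
      ring
    rw [← compl_Ioi, probReal_compl_eq_one_sub measurableSet_Ioi,
      probReal_compl_eq_one_sub measurableSet_Ioi, measureReal_def, measureReal_def, e]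
  intro i
  refine le_trans (le_of_eq ?_) (h i)
  exact setIntegral_congr_fun measurableSet_Ioi fun x hx => by simp only [key x hx]

/-- Competing exponential clocks: the integrand is λ/(μ+λ) times the exponential density of rate μ +
λ. -/
lemma arrivalLaw_expMeasure_Ici_one {lam : ℝ≥0} {mu : ℝ} (hmu : 0 < mu) :
    arrivalLaw lam (expMeasure mu) (Ici 1) = ENNReal.ofReal (lam / (mu + lam)) := by
  have := isProbabilityMeasure_expMeasure hmu
  have hpos : 0 < mu.toNNReal + lam := by positivity
  have h := arrivalLaw_Ici_succ lam (expMeasure mu) 0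
  rw [zero_add] at h
  rw [h, ← mul_one (ENNReal.ofReal _), ← lintegral_erlangPDF_zero hpos,
    ← lintegral_const_mul _ (measurable_erlangPDF _ _)]
  congr 1 with t
  by_cases ht : 0 < t
  · rw [expMeasure_Ioi hmu ht.le]
    simp only [erlangPDF, indicator, mem_Ioi, ht, if_true]
    rw [← ENNReal.ofReal_mul (erlangPDFReal_nonneg _ _ ht.le), ← ENNReal.ofReal_mul (by positivity)]
    congr 1
    have e : Real.exp (-(mu + lam) * t) = Real.exp (-lam * t) * Real.exp (-(mu * t)) := by
      rw [← Real.exp_add]; ring_nf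
    have : mu + lam ≠ 0 := by positivity
    simp only [erlangPDFReal, NNReal.coe_add, Real.coe_toNNReal _ hmu.le, e]
    simp
    field_simp
  · simp [erlangPDF, indicator, ht]

lemma toReal_arrivalLaw_zero (lam : ℝ≥0) (F : Measure ℝ) [IsProbabilityMeasure F] :
    (arrivalLaw lam F {0}).toReal = 1 - (arrivalLaw lam F (Ici 1)).toReal := by
  have huniv : (Ici 0 : Set ℕ) = univ := by ext; simp
  have h := measure_Ici_eq_add (arrivalLaw lam F) 0
  rw [huniv, measure_univ] at h
  have := congrArg ENNReal.toReal h
  rw [ENNReal.toReal_add (measure_ne_top _ _) (measure_ne_top _ _)] at this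
  simp at this
  linarith

lemma toReal_arrivalLaw_expMeasure_zero {lam : ℝ≥0} {mu : ℝ} (hmu : 0 < mu) :
    (arrivalLaw lam (expMeasure mu) {0}).toReal = mu / (mu + lam) := by
  have := isProbabilityMeasure_expMeasure hmu
  have : mu + lam ≠ 0 := by positivity
  rw [toReal_arrivalLaw_zero, arrivalLaw_expMeasure_Ici_one hmu,
    ENNReal.toReal_ofReal (by positivity)]
  field_simp
  ring

lemma toReal_arrivalLaw_eq_integral_exp (lam : ℝ≥0) (F : Measure ℝ) [IsProbabilityMeasure F]
    (h0 : F (Iio 0) = 0) : (arrivalLaw lam F {0}).toReal = ∫ x, Real.exp (-lam * x) ∂F := by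
  rw [toReal_arrivalLaw_singleton lam F h0]
  simp

lemma arrivalLaw_Ici_one_le_add {lam : ℝ≥0} (hlam : 0 < lam) (F G : Measure ℝ) [SFinite F]
    [SFinite G] {c : ℝ≥0∞} (h : ∀ x : ℝ, 0 < x → F (Ioi x) ≤ G (Ioi x) + c) :
    arrivalLaw lam F (Ici 1) ≤ arrivalLaw lam G (Ici 1) + c := by
  have hF := arrivalLaw_Ici_succ lam F 0
  have hG := arrivalLaw_Ici_succ lam G 0
  rw [zero_add] at hF hG
  have hm := measurable_erlangPDF lam 0
  calc arrivalLaw lam F (Ici 1) ≤ ∫⁻ x, (erlangPDF lam 0 x * G (Ioi x) + erlangPDF lam 0 x * c) := by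
        rw [hF]
        refine lintegral_mono fun x => ?_
        by_cases hx : 0 < x
        · rw [← mul_add]
          gcongr
          exact h x hx
        · simp [erlangPDF, indicator, hx]
    _ = _ := by
        rw [lintegral_add_left (measurable_erlangPDF_mul_Ioi lam 0 G), lintegral_mul_const _ hm,
          lintegral_erlangPDF_zero hlam, one_mul, hG]

lemma lintegral_measure_Ioi (F : Measure ℝ) (h0 : F (Iio 0) = 0) (hF : Integrable (fun x => x) F) :
    ∫⁻ t in Ioi (0 : ℝ), F (Ioi t) = ENNReal.ofReal (∫ x, x ∂F) := by
  have hpos : ∀ᵐ x ∂F, (0 : ℝ) ≤ x := by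
    rw [ae_iff]
    simpa [← Iio_def] using h0
  rw [ofReal_integral_eq_lintegral_ofReal hF hpos,
    lintegral_eq_lintegral_meas_lt F hpos aemeasurable_id']
  rfl

/-- Integrating the tails over all ages: `λ` times the transform of the integrated tail. -/
lemma lintegral_erlangPDF_integrated_tail {lam : ℝ≥0} (hlam : 0 < lam) (F : Measure ℝ)
    [IsProbabilityMeasure F] :
    (∫⁻ x, erlangPDF lam 0 x * ∫⁻ t in Ioi (0 : ℝ), F (Ioi (x + t))) +
      arrivalLaw lam F (Ici 1) / lam = ∫⁻ t in Ioi (0 : ℝ), F (Ioi t) := by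
  have hm := measurable_erlangPDF lam 0
  have hF := measurable_measure_Ioi F
  have hl : (lam : ℝ≥0∞) ≠ 0 := by simpa using hlam.ne'
  have h1 : ∀ x, 0 < x → ∫⁻ t in Ioi (0 : ℝ), F (Ioi (x + t)) =
      ∫⁻ s, (Ioi x).indicator (fun s => F (Ioi s)) s := by
    intro x hx
    rw [← lintegral_indicator measurableSet_Ioi,
      ← lintegral_add_right_eq_self ((Ioi x).indicator fun s => F (Ioi s)) x]
    congr 1 with t
    by_cases ht : 0 < t <;> simp [indicator, ht, add_comm]
  have h2 : ∫⁻ x, erlangPDF lam 0 x * ∫⁻ t in Ioi (0 : ℝ), F (Ioi (x + t)) =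
      ∫⁻ x, ∫⁻ s, erlangPDF lam 0 x * (Ioi x).indicator (fun s => F (Ioi s)) s := by
    congr 1 with x
    rw [lintegral_const_mul _ (hF.indicator measurableSet_Ioi)]
    by_cases hx : 0 < x
    · rw [h1 x hx]
    · simp [erlangPDF, indicator, hx]
  have hmeas : Measurable fun z : ℝ × ℝ =>
      erlangPDF lam 0 z.1 * (Ioi z.1).indicator (fun s => F (Ioi s)) z.2 := by
    refine (hm.comp measurable_fst).mul ?_
    have : (fun z : ℝ × ℝ => (Ioi z.1).indicator (fun s => F (Ioi s)) z.2) =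
        {z : ℝ × ℝ | z.1 < z.2}.indicator fun z => F (Ioi z.2) := by
      ext z; simp [indicator]
    rw [this]
    exact (hF.comp measurable_snd).indicator (measurableSet_lt measurable_fst measurable_snd)
  -- For fixed s the integral over x < s is the probability of an arrival before s.
  have h3 : ∀ s, ∫⁻ x, erlangPDF lam 0 x * (Ioi x).indicator (fun s => F (Ioi s)) s =
      poissonMeasure (lam * s.toNNReal) (Ici 1) * F (Ioi s) := by
    intro s
    have := poissonMeasure_Ici_succ lam 0 s
    rw [zero_add] at this
    rw [this, ← lintegral_indicator measurableSet_Ioo, ← lintegral_mul_const]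
    · congr 1 with x
      by_cases h1 : 0 < x <;> by_cases h2 : x < s <;> simp [erlangPDF, indicator, h1, h2]
    · exact (continuous_erlangPDFReal lam 0).measurable.ennreal_ofReal.indicator measurableSet_Ioo
  have h4 := arrivalLaw_Ici_succ lam F 0
  rw [zero_add] at h4
  rw [h2, lintegral_lintegral_swap hmeas.aemeasurable, h4, div_eq_mul_inv,
    ← lintegral_mul_const _ (measurable_erlangPDF_mul_Ioi lam 0 F),
    ← lintegral_add_right _ ((measurable_erlangPDF_mul_Ioi lam 0 F).mul_const _),
    ← lintegral_indicator measurableSet_Ioi]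
  congr 1 with s
  rw [h3]
  by_cases hs : 0 < s
  · have e1 : erlangPDF lam 0 s * (lam : ℝ≥0∞)⁻¹ = poissonMeasure (lam * s.toNNReal) {0} := by
      simp only [erlangPDF, indicator, mem_Ioi, hs, if_true, erlangPDFReal]
      rw [ENNReal.ofReal_mul (by positivity), poissonMeasure_singleton, mul_comm, ← mul_assoc,
        ENNReal.ofReal_coe_nnreal, ENNReal.inv_mul_cancel hl (by simp), one_mul]
      simp [hs.le]
    have e2 : poissonMeasure (lam * s.toNNReal) (Ici 1) +
        poissonMeasure (lam * s.toNNReal) {0} = 1 := by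
      rw [← measure_union _ .of_discrete, ← measure_univ (μ := poissonMeasure (lam * s.toNNReal))]
      · congr 1
        ext n; simp; omega
      · simp
    simp only [indicator, mem_Ioi, hs, if_true]
    calc _ = (poissonMeasure (lam * s.toNNReal) (Ici 1) + erlangPDF lam 0 s * (lam : ℝ≥0∞)⁻¹) *
        F (Ioi s) := by ring
      _ = _ := by rw [e1, e2, one_mul]
  · simp [erlangPDF, indicator, hs, Real.toNNReal_of_nonpos (not_lt.1 hs),
      show (Ici 1 : Set ℕ) = {0}ᶜ by ext n; simp; omega, poissonMeasure_singleton]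

/-! ### Closeness to the exponential law -/

lemma ConditionB.Iio_zero {p mu eps : ℝ} {F : Measure ℝ} (hB : ConditionB p mu eps F) :
    F (Iio 0) = 0 := measure_mono_null Iio_subset_Iic_self hB.pos

lemma ConditionB.residual_Ioi_le {p mu eps : ℝ} {F : Measure ℝ} (hB : ConditionB p mu eps F)
    {x y : ℝ} (hx : 0 ≤ x) (hy : 0 ≤ y) (hF : 0 < F (Ioi y)) :
    residual F y (Ioi x) ≤ F (Ioi x) + ENNReal.ofReal eps ∧
      F (Ioi x) ≤ residual F y (Ioi x) + ENNReal.ofReal eps := by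
  have := hB.prob
  have := isProbabilityMeasure_residual F hF
  have h := abs_le.1 (hB.close x y hx hy hF)
  have hc : ∀ Ξ : Measure ℝ, [IsProbabilityMeasure Ξ] →
      Ξ (Ioi x) = ENNReal.ofReal (1 - Ξ.real (Iic x)) := fun Ξ _ => by
    rw [← probReal_compl_eq_one_sub measurableSet_Iic, compl_Iic, ofReal_measureReal]
  have h1 : ∀ Ξ : Measure ℝ, [IsProbabilityMeasure Ξ] → 0 ≤ 1 - Ξ.real (Iic x) := fun Ξ _ =>
    sub_nonneg.2 measureReal_le_one
  rw [hc, hc, ← ENNReal.ofReal_add (h1 _) hB.eps_pos.le, ← ENNReal.ofReal_add (h1 _) hB.eps_pos.le]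
  exact ⟨ENNReal.ofReal_le_ofReal (by linarith [h.1]), ENNReal.ofReal_le_ofReal (by linarith [h.2])⟩

lemma ConditionB.abs_residual_sub_le {p mu eps : ℝ} {F : Measure ℝ} (hB : ConditionB p mu eps F)
    {lam : ℝ≥0} (hlam : 0 < lam) {y : ℝ} (hy : 0 ≤ y) (hF : 0 < F (Ioi y)) :
    |(arrivalLaw lam (residual F y) {0}).toReal - (arrivalLaw lam F {0}).toReal| ≤ eps := by
  have := hB.prob
  have := isProbabilityMeasure_residual F hF
  have h1 := arrivalLaw_Ici_one_le_add hlam (residual F y) F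
    fun x hx => (hB.residual_Ioi_le hx.le hy hF).1
  have h2 := arrivalLaw_Ici_one_le_add hlam F (residual F y)
    fun x hx => (hB.residual_Ioi_le hx.le hy hF).2
  have conv : ∀ {a b : ℝ≥0∞}, a ≠ ∞ → b ≠ ∞ → a ≤ b + ENNReal.ofReal eps →
      a.toReal ≤ b.toReal + eps := fun {a b} ha hb h => by
    have := ENNReal.toReal_mono (by finiteness) h
    rwa [ENNReal.toReal_add hb ENNReal.ofReal_ne_top, ENNReal.toReal_ofReal hB.eps_pos.le] at this
  have h1 := conv (measure_ne_top _ _) (measure_ne_top _ _) h1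
  have h2 := conv (measure_ne_top _ _) (measure_ne_top _ _) h2
  rw [toReal_arrivalLaw_zero, toReal_arrivalLaw_zero, abs_le]
  constructor <;> linarith

lemma ConditionB.lintegral_tail {p mu eps : ℝ} {F : Measure ℝ} (hB : ConditionB p mu eps F) :
    ∫⁻ t in Ioi (0 : ℝ), F (Ioi t) = ENNReal.ofReal (1 / mu) := by
  rw [← hB.mean]
  -- The mean 1/μ is nonzero, which forces integrability: the Bochner integral of a non-integrable
  -- function is zero.
  refine lintegral_measure_Ioi F hB.Iio_zero (Integrable.of_integral_ne_zero ?_)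
  rw [hB.mean]
  exact (one_div_pos.2 hB.mu_pos).ne'

lemma ConditionB.measure_Ioi_add_le {p mu eps : ℝ} {F : Measure ℝ} (hB : ConditionB p mu eps F)
    {x y : ℝ} (hx : 0 ≤ x) (hy : 0 ≤ y) :
    F (Ioi (x + y)) ≤ F (Ioi y) * (F (Ioi x) + ENNReal.ofReal eps) ∧
      F (Ioi y) * F (Ioi x) ≤ F (Ioi (x + y)) + F (Ioi y) * ENNReal.ofReal eps := by
  have := hB.prob
  rcases eq_or_ne (F (Ioi y)) 0 with h | h
  · simp only [h, zero_mul, zero_le, and_true, add_zero]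
    exact (measure_mono (Ioi_subset_Ioi (by linarith))).trans h.le
  · have h := pos_iff_ne_zero.2 h
    have h1 := hB.residual_Ioi_le hx hy h
    rw [measure_Ioi_add F hx h, ← mul_add]
    exact ⟨mul_le_mul' le_rfl h1.1, mul_le_mul' le_rfl h1.2⟩

/-- A law close to all its residual laws has nearly the transform of the exponential law. -/
lemma ConditionB.abs_sub_exp_le {p mu eps : ℝ} {F : Measure ℝ} (hB : ConditionB p mu eps F)
    {lam : ℝ≥0} (hlam : 0 < lam) :
    |(arrivalLaw lam F {0}).toReal - mu / (mu + lam)| ≤ eps := by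
  have := hB.prob
  have hmu := hB.mu_pos
  have hl : (0 : ℝ) < lam := hlam
  have hm := measurable_erlangPDF lam 0
  have hF := measurable_measure_Ioi F
  have hT := arrivalLaw_Ici_succ lam F 0
  rw [zero_add] at hT
  have hD := lintegral_erlangPDF_integrated_tail hlam F
  rw [hB.lintegral_tail] at hD
  set T := arrivalLaw lam F (Ici 1) with hTdef
  set A := ENNReal.ofReal (1 / mu) with hA
  set D := ∫⁻ x, erlangPDF lam 0 x * ∫⁻ t in Ioi (0 : ℝ), F (Ioi (x + t))
  -- Closeness of F_t to F, integrated over the ages t, gives |D - T/μ| ≤ ε/μ. With D + T/λ = 1/μ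
  -- this determines T up to λε/(μ+λ) ≤ ε around its exponential value λ/(μ+λ).
  have up : D ≤ A * (T + ENNReal.ofReal eps) := by
    calc D ≤ ∫⁻ x, A * (erlangPDF lam 0 x * F (Ioi x) + erlangPDF lam 0 x * ENNReal.ofReal eps) := by
          refine lintegral_mono fun x => ?_
          by_cases hx : 0 < x
          · have : ∫⁻ t in Ioi (0 : ℝ), F (Ioi (x + t)) ≤ A * (F (Ioi x) + ENNReal.ofReal eps) := by
              rw [hA, ← hB.lintegral_tail, ← lintegral_mul_const _ hF]
              exact setLIntegral_mono (hF.mul_const _)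
                fun t ht => (hB.measure_Ioi_add_le hx.le (le_of_lt ht)).1
            calc _ ≤ erlangPDF lam 0 x * (A * (F (Ioi x) + ENNReal.ofReal eps)) :=
                  mul_le_mul' le_rfl this
              _ = _ := by ring
          · simp [erlangPDF, indicator, hx]
      _ = _ := by
          rw [lintegral_const_mul' _ _ ENNReal.ofReal_ne_top,
            lintegral_add_left (measurable_erlangPDF_mul_Ioi lam 0 F),
            lintegral_mul_const _ hm, lintegral_erlangPDF_zero hlam, one_mul, hT]
  have low : A * T ≤ D + A * ENNReal.ofReal eps := by
    calc A * T = ∫⁻ x, A * (erlangPDF lam 0 x * F (Ioi x)) := by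
          rw [lintegral_const_mul _ (measurable_erlangPDF_mul_Ioi lam 0 F), hT]
      _ ≤ ∫⁻ x, (erlangPDF lam 0 x * (∫⁻ t in Ioi (0 : ℝ), F (Ioi (x + t))) +
            erlangPDF lam 0 x * (A * ENNReal.ofReal eps)) := by
          refine lintegral_mono fun x => ?_
          by_cases hx : 0 < x
          · have : A * F (Ioi x) ≤
                (∫⁻ t in Ioi (0 : ℝ), F (Ioi (x + t))) + A * ENNReal.ofReal eps := by
              rw [hA, ← hB.lintegral_tail, ← lintegral_mul_const _ hF, ← lintegral_mul_const _ hF,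
                ← lintegral_add_right _ (hF.mul_const _)]
              exact setLIntegral_mono ((hF.comp (measurable_const_add x)).add (hF.mul_const _))
                fun t ht => (hB.measure_Ioi_add_le hx.le (le_of_lt ht)).2
            calc _ = erlangPDF lam 0 x * (A * F (Ioi x)) := by ring
              _ ≤ _ := by
                rw [← mul_add]
                exact mul_le_mul' le_rfl this
          · simp [erlangPDF, indicator, hx]
      _ = _ := by
          rw [lintegral_add_right _ (hm.mul_const _), lintegral_mul_const _ hm,
            lintegral_erlangPDF_zero hlam, one_mul]
  have hTf : T ≠ ∞ := measure_ne_top _ _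
  have hAf : A ≠ ∞ := ENNReal.ofReal_ne_top
  have hDf : D ≠ ∞ := fun h => by simp [h] at hD; exact hAf hD.symm
  have hlf : (lam : ℝ≥0∞) ≠ 0 := by simpa using hlam.ne'
  have hTlf : T / lam ≠ ∞ := ENNReal.div_ne_top hTf hlf
  have hAr : A.toReal = 1 / mu := ENNReal.toReal_ofReal (by positivity)
  have hD := congrArg ENNReal.toReal hD
  rw [ENNReal.toReal_add hDf hTlf, ENNReal.toReal_div, ENNReal.coe_toReal, hAr] at hD
  have up := ENNReal.toReal_mono (by finiteness) up
  rw [ENNReal.toReal_mul, ENNReal.toReal_add hTf (by finiteness),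
    ENNReal.toReal_ofReal hB.eps_pos.le, hAr] at up
  have low := ENNReal.toReal_mono (by finiteness) low
  rw [ENNReal.toReal_mul, ENNReal.toReal_add hDf (by finiteness), ENNReal.toReal_mul,
    ENNReal.toReal_ofReal hB.eps_pos.le, hAr] at low
  rw [toReal_arrivalLaw_zero, ← hTdef]
  set τ := T.toReal
  set d := D.toReal
  have hd : d = 1 / mu - τ / lam := by linarith
  rw [hd] at up low
  have heps := hB.eps_pos
  have up' : lam - mu * τ ≤ lam * (τ + eps) := by
    have := mul_le_mul_of_nonneg_left up (mul_pos hmu hl).le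
    field_simp at this
    linarith
  have low' : lam * τ ≤ lam - mu * τ + lam * eps := by
    have := mul_le_mul_of_nonneg_left low (mul_pos hmu hl).le
    field_simp at this
    linarith
  have hs : 0 < mu + lam := by positivity
  have e : 1 - τ - mu / (mu + lam) = (lam - (mu + lam) * τ) / (mu + lam) := by
    field_simp
    ring
  have : 0 < mu * eps := by positivity
  rw [e, abs_div, abs_of_pos hs, div_le_iff₀ hs, abs_le]
  constructor <;> nlinarith

/-! ### The number of arrivals during one service -/

lemma isProbabilityMeasure_serviceLaw {p mu : ℝ} {F : Measure ℝ} [IsProbabilityMeasure F]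
    (hp : 0 ≤ p) (hp1 : p ≤ 1) (hmu : 0 < mu) : IsProbabilityMeasure (serviceLaw p mu F) := by
  have := isProbabilityMeasure_expMeasure hmu
  refine ⟨?_⟩
  rw [serviceLaw]
  simp [← ENNReal.ofReal_add hp (sub_nonneg.2 hp1)]

lemma ConditionB.serviceLaw_Iic_zero {p mu eps : ℝ} {F : Measure ℝ} (hB : ConditionB p mu eps F) :
    serviceLaw p mu F (Iic 0) = 0 := by
  simp [serviceLaw, hB.pos, expMeasure_Iic_zero hB.mu_pos]

lemma arrivalLaw_serviceLaw (lam : ℝ≥0) (p mu : ℝ) (F : Measure ℝ) (s : Set ℕ) :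
    arrivalLaw lam (serviceLaw p mu F) s = ENNReal.ofReal p * arrivalLaw lam F s +
      ENNReal.ofReal (1 - p) * arrivalLaw lam (expMeasure mu) s := by
  simp [arrivalLaw_apply, serviceLaw, lintegral_add_measure, lintegral_smul_measure]

lemma ConditionB.toReal_arrivalLaw_serviceLaw_zero {p mu eps : ℝ} {F : Measure ℝ}
    (hB : ConditionB p mu eps F) (lam : ℝ≥0) :
    (arrivalLaw lam (serviceLaw p mu F) {0}).toReal = serviceLST lam p mu F := by
  have := hB.prob
  have := isProbabilityMeasure_expMeasure hB.mu_pos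
  rw [arrivalLaw_serviceLaw, ENNReal.toReal_add (by finiteness) (by finiteness), ENNReal.toReal_mul,
    ENNReal.toReal_mul, ENNReal.toReal_ofReal hB.p_pos.le,
    ENNReal.toReal_ofReal (sub_nonneg.2 hB.p_le_one), toReal_arrivalLaw_expMeasure_zero hB.mu_pos,
    toReal_arrivalLaw_eq_integral_exp lam F hB.Iio_zero, serviceLST]

/-- The complement of `arrivalLaw_Ici_mul_le` with m = 1: one further arrival is at least as likely
as under G, so none is at most as likely. -/
lemma arrivalLaw_singleton_le {lam : ℝ≥0} (hlam : 0 < lam) (F G : Measure ℝ)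
    [IsProbabilityMeasure F] [IsProbabilityMeasure G] (h0 : F (Iic 0) = 0)
    (h : ∀ y : ℝ, 0 ≤ y → 0 < F (Ioi y) → CLE lam G (residual F y)) (i : ℕ) :
    arrivalLaw lam F {i} ≤ arrivalLaw lam G {0} * arrivalLaw lam F (Ici i) := by
  have h1 := arrivalLaw_Ici_mul_le hlam F G h0 h i 1
  have h2 := measure_Ici_eq_add (arrivalLaw lam F) i
  have h3 := measure_Ici_eq_add (arrivalLaw lam G) 0
  rw [show (Ici 0 : Set ℕ) = univ by ext; simp, measure_univ, zero_add] at h3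
  refine (ENNReal.add_le_add_iff_right (measure_ne_top (arrivalLaw lam F) (Ici (i + 1)))).1 ?_
  calc arrivalLaw lam F {i} + arrivalLaw lam F (Ici (i + 1))
      = (arrivalLaw lam G {0} + arrivalLaw lam G (Ici 1)) * arrivalLaw lam F (Ici i) := by
        rw [h2, h3, one_mul]
    _ = arrivalLaw lam G {0} * arrivalLaw lam F (Ici i) +
          arrivalLaw lam F (Ici i) * arrivalLaw lam G (Ici 1) := by ring
    _ ≤ _ := by gcongr

/-- An upper bound for the probability that no customer arrives during a residual service. -/
noncomputable def emptyProb (lam : ℝ≥0) (mu : ℝ) (F : Measure ℝ) (y₀ : ℝ) : ℝ :=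
  max (arrivalLaw lam (residual F y₀) {0}).toReal (mu / (mu + lam))

lemma serviceLST_pos {p mu eps : ℝ} {F : Measure ℝ} (hB : ConditionB p mu eps F) (lam : ℝ≥0) :
    0 < serviceLST lam p mu F := by
  have := hB.prob
  have hφ : 0 < ∫ x, Real.exp (-lam * x) ∂F := by
    refine integral_exp_pos (Integrable.of_bound (by fun_prop) 1 ?_)
    have : ∀ᵐ x ∂F, (0 : ℝ) ≤ x := by
      rw [ae_iff]
      simpa [← Iio_def] using hB.Iio_zero
    filter_upwards [this] with x hx
    rw [Real.norm_of_nonneg (Real.exp_nonneg _)]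
    exact Real.exp_le_one_iff.2 (by nlinarith [lam.coe_nonneg])
  have hp := hB.p_pos
  have hmu := hB.mu_pos
  have : 0 ≤ (1 - p) * (mu / (mu + lam)) :=
    mul_nonneg (sub_nonneg.2 hB.p_le_one) (by positivity)
  rw [serviceLST]
  positivity

section

variable {p mu eps : ℝ} {F : Measure ℝ} {lam : ℝ≥0} {y₀ : ℝ}

lemma emptyProb_le_one (hB : ConditionB p mu eps F) (hD : IsLeastResidual lam F y₀) :
    emptyProb lam mu F y₀ ≤ 1 := by
  have := hB.prob
  have := isProbabilityMeasure_residual F hD.tail_pos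
  have hmu := hB.mu_pos
  refine max_le ?_ ?_
  · exact ENNReal.toReal_mono ENNReal.one_ne_top prob_le_one
  · rw [div_le_one (by positivity)]
    linarith [lam.coe_nonneg]

lemma arrivalLaw_serviceLaw_singleton_le (hlam : 0 < lam) (hB : ConditionB p mu eps F)
    (hD : IsLeastResidual lam F y₀) (i : ℕ) :
    arrivalLaw lam (serviceLaw p mu F) {i} ≤
      ENNReal.ofReal (emptyProb lam mu F y₀) * arrivalLaw lam (serviceLaw p mu F) (Ici i) := by
  have := hB.prob
  have hmu := hB.mu_pos
  have := isProbabilityMeasure_residual F hD.tail_pos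
  have := isProbabilityMeasure_expMeasure hmu
  have h1 := arrivalLaw_singleton_le hlam F (residual F y₀) hB.pos hD.least i
  have h2 := arrivalLaw_singleton_le hlam (expMeasure mu) (expMeasure mu)
    (expMeasure_Iic_zero hmu) (fun y hy _ => (CLE.refl lam _).residual_expMeasure hmu hy) i
  have h3 : arrivalLaw lam (residual F y₀) {0} ≤ ENNReal.ofReal (emptyProb lam mu F y₀) := by
    rw [← ENNReal.ofReal_toReal (measure_ne_top (arrivalLaw lam (residual F y₀)) {0})]
    exact ENNReal.ofReal_le_ofReal (le_max_left _ _)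
  have h4 : arrivalLaw lam (expMeasure mu) {0} ≤ ENNReal.ofReal (emptyProb lam mu F y₀) := by
    rw [← ENNReal.ofReal_toReal (measure_ne_top (arrivalLaw lam (expMeasure mu)) {0}),
      toReal_arrivalLaw_expMeasure_zero hmu]
    exact ENNReal.ofReal_le_ofReal (le_max_right _ _)
  rw [arrivalLaw_serviceLaw, arrivalLaw_serviceLaw]
  calc _ ≤ ENNReal.ofReal p * (ENNReal.ofReal (emptyProb lam mu F y₀) * arrivalLaw lam F (Ici i)) +
        ENNReal.ofReal (1 - p) * (ENNReal.ofReal (emptyProb lam mu F y₀) *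
          arrivalLaw lam (expMeasure mu) (Ici i)) := by
        gcongr
        · exact h1.trans (mul_le_mul' h3 le_rfl)
        · exact h2.trans (mul_le_mul' h4 le_rfl)
    _ = _ := by ring

lemma arrivalLaw_serviceLaw_Ici_mul_le (hlam : 0 < lam) (hB : ConditionB p mu eps F)
    (hD : IsLeastResidual lam F y₀) (G : Measure ℝ) [IsProbabilityMeasure G]
    (hGF : CLE lam G (residual F y₀)) (hGE : CLE lam G (expMeasure mu)) (i m : ℕ) :
    arrivalLaw lam (serviceLaw p mu F) (Ici i) * arrivalLaw lam G (Ici m) ≤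
      arrivalLaw lam (serviceLaw p mu F) (Ici (i + m)) := by
  have := hB.prob
  have hmu := hB.mu_pos
  have := isProbabilityMeasure_expMeasure hmu
  have h1 := arrivalLaw_Ici_mul_le hlam F G hB.pos (fun y hy h => hGF.trans (hD.least y hy h)) i m
  have h2 := arrivalLaw_Ici_mul_le hlam (expMeasure mu) G (expMeasure_Iic_zero hmu)
    (fun y hy _ => hGE.residual_expMeasure hmu hy) i m
  simp only [arrivalLaw_serviceLaw, add_mul, mul_assoc]
  gcongr

lemma serviceLST_le_emptyProb (hlam : 0 < lam) (hB : ConditionB p mu eps F)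
    (hD : IsLeastResidual lam F y₀) : serviceLST lam p mu F ≤ emptyProb lam mu F y₀ := by
  have := hB.prob
  have := isProbabilityMeasure_serviceLaw (F := F) hB.p_pos.le hB.p_le_one hB.mu_pos
  have hr : 0 ≤ emptyProb lam mu F y₀ := ENNReal.toReal_nonneg.trans (le_max_left _ _)
  have h := arrivalLaw_serviceLaw_singleton_le hlam hB hD 0
  rw [show (Ici 0 : Set ℕ) = univ by ext; simp, measure_univ, mul_one] at h
  rw [← hB.toReal_arrivalLaw_serviceLaw_zero]
  exact ENNReal.toReal_le_of_le_ofReal hr h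

lemma emptyProb_sub_serviceLST_lt (hlam : 0 < lam) (hB : ConditionB p mu eps F)
    (hD : IsLeastResidual lam F y₀) :
    emptyProb lam mu F y₀ - serviceLST lam p mu F < 3 * eps := by
  have := hB.prob
  have h1 := abs_le.1 (hB.abs_residual_sub_le hlam hD.nonneg hD.tail_pos)
  have h2 := abs_le.1 (hB.abs_sub_exp_le hlam)
  rw [serviceLST, ← toReal_arrivalLaw_eq_integral_exp lam F hB.Iio_zero, sub_lt_iff_lt_add]
  have hp := hB.p_pos
  have hp1 := hB.p_le_one
  have heps := hB.eps_pos
  set φ := (arrivalLaw lam F {0}).toReal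
  -- The two candidates exceed b by at most ε + (1 - p)ε and pε respectively.
  refine max_lt ?_ ?_ <;> nlinarith

end

/-! ### Arrivals during successive services are independent -/

/-- The least point of the grid `ℕ / (M + 1)` not to the left of `t`. -/
noncomputable def gridCeil (M : ℕ) (t : ℝ≥0) : ℝ≥0 := (⌈t * (M + 1)⌉₊ : ℝ≥0) / (M + 1)

lemma le_gridCeil (M : ℕ) (t : ℝ≥0) : t ≤ gridCeil M t := by
  rw [gridCeil, le_div_iff₀ (by positivity)]
  exact Nat.le_ceil _

lemma gridCeil_le (M : ℕ) (t : ℝ≥0) : gridCeil M t ≤ t + 1 / (M + 1) := by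
  rw [gridCeil, div_le_iff₀ (by positivity), add_mul, one_div_mul_cancel (by positivity)]
  have h : ((⌈((t * (M + 1) : ℝ≥0) : ℝ)⌉₊ : ℕ) : ℝ) ≤ (t * (M + 1) : ℝ≥0) + 1 :=
    (Nat.ceil_lt_add_one (NNReal.coe_nonneg _)).le
  have e : ⌈((t * (M + 1) : ℝ≥0) : ℝ)⌉₊ = ⌈t * (M + 1)⌉₊ := Nonneg.nat_ceil_coe _
  rw [e] at h
  exact_mod_cast h

lemma monotone_gridCeil (M : ℕ) : Monotone (gridCeil M) := fun s t h => by
  unfold gridCeil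
  gcongr

lemma tendsto_gridCeil (t : ℝ≥0) : Tendsto (fun M => gridCeil M t) atTop (𝓝[≥] t) := by
  refine tendsto_nhdsWithin_iff.2 ⟨?_, .of_forall fun M => le_gridCeil M t⟩
  refine tendsto_of_tendsto_of_tendsto_of_le_of_le tendsto_const_nhds ?_
    (fun M => le_gridCeil M t) (fun M => gridCeil_le M t)
  have := (tendsto_one_div_add_atTop_nhds_zero_nat (𝕜 := ℝ≥0)).const_add t
  simpa using this

/-- Evaluation of a path at a random time need not be measurable for the product σ-algebra; it is
when the time takes values in a countable grid. -/
lemma measurable_eval_gridCeil (M : ℕ) {α : Type*} [MeasurableSpace α] {f : α → ℝ≥0 → ℕ}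
    (hf : Measurable f) {τ : α → ℝ≥0} (hτ : Measurable τ) :
    Measurable fun z => f z (gridCeil M (τ z)) := by
  have h : Measurable fun q : (ℝ≥0 → ℕ) × ℕ => q.1 ((q.2 : ℝ≥0) / (M + 1)) :=
    measurable_from_prod_countable_left fun k => measurable_pi_apply ((k : ℝ≥0) / (M + 1))
  exact h.comp (hf.prodMk (Nat.measurable_ceil.comp (hτ.mul_const _)))

lemma IsPoissonProcess.eventually_gridCeil_eq [MeasurableSpace Ω] {P : Measure Ω} {lam : ℝ≥0}
    {N : ℝ≥0 → Ω → ℕ} (hN : IsPoissonProcess P lam N) (ω : Ω) (t : ℝ≥0) :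
    ∀ᶠ M in atTop, N (gridCeil M t) ω = N t ω := by
  have h := (hN.right_continuous ω t).tendsto.comp (tendsto_gridCeil t)
  rw [nhds_discrete, tendsto_pure] at h
  exact h

lemma IsPoissonProcess.measure_increments [MeasurableSpace Ω] {P : Measure Ω} {lam : ℝ≥0}
    {N : ℝ≥0 → Ω → ℕ} (hN : IsPoissonProcess P lam N) {s : ℕ → ℝ≥0} (hs : Monotone s)
    (T : ℕ) (x : ℕ → ℕ) :
    P {ω | ∀ j < T, N (s (j + 1)) ω - N (s j) ω = x j} =
      ∏ j ∈ Finset.range T, poissonMeasure (lam * (s (j + 1) - s j)) {x j} := by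
  have h := (hN.indep_increments.nat hs).measure_inter_preimage_eq_mul (Finset.range T)
    (sets := fun j => {x j}) fun _ _ => .of_discrete
  have e : {ω | ∀ j < T, N (s (j + 1)) ω - N (s j) ω = x j} =
      ⋂ j ∈ Finset.range T, (fun ω => N (s (j + 1)) ω - N (s j) ω) ⁻¹' {x j} := by
    ext; simp
  rw [e, h]
  refine Finset.prod_congr rfl fun j _ => ?_
  rw [← hN.increment_law (s j) (s (j + 1)) (hs j.le_succ), Measure.map_apply _ .of_discrete]
  exact (hN.measurable _).sub (hN.measurable _)

lemma measurable_epoch [MeasurableSpace Ω] {χ : ℕ → Ω → ℝ} (hχ : ∀ i, Measurable (χ i)) (k : ℕ) :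
    Measurable (epoch χ k) := by
  unfold epoch
  fun_prop

lemma epoch_mono {χ : ℕ → Ω → ℝ} {ω : Ω} (h : ∀ i, 0 ≤ χ i ω) : Monotone fun k => epoch χ k ω :=
  monotone_nat_of_le_succ fun k => by
    unfold epoch
    rw [Finset.sum_range_succ]
    exact Real.toNNReal_le_toNNReal (by linarith [h k])

lemma epoch_succ_sub {χ : ℕ → Ω → ℝ} {ω : Ω} (h : ∀ i, 0 ≤ χ i ω) (k : ℕ) :
    epoch χ (k + 1) ω - epoch χ k ω = (χ k ω).toNNReal := by
  unfold epoch
  rw [Finset.sum_range_succ, Real.toNNReal_add (Finset.sum_nonneg fun i _ => h i) (h k),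
    add_tsub_cancel_left]

section

variable [MeasurableSpace Ω] {P : Measure Ω} {lam : ℝ≥0}
  {B : Measure ℝ} {N : ℝ≥0 → Ω → ℕ} {χ : ℕ → Ω → ℝ}

lemma IsMGIInput.ae_nonneg (hM : IsMGIInput P lam B N χ) (h0 : B (Iio 0) = 0) :
    ∀ᵐ ω ∂P, ∀ i, 0 ≤ χ i ω := by
  refine ae_all_iff.2 fun i => ?_
  rw [← hM.service_law i, Measure.map_apply (hM.measurable_service i) measurableSet_Iio] at h0
  rw [ae_iff]
  simpa [preimage, Iio] using h0

lemma IsMGIInput.measurable_arrivalsDuring (hM : IsMGIInput P lam B N χ) (k : ℕ) :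
    Measurable fun ω => arrivalsDuring N χ ω k := by
  have hN : Measurable fun ω t => N t ω := measurable_pi_lambda _ hM.arrivals.measurable
  have h : ∀ k, Measurable fun ω => N (epoch χ k ω) ω := fun k =>
    measurable_of_tendsto_metrizable
      (fun M => measurable_eval_gridCeil M hN (measurable_epoch hM.measurable_service k))
      (tendsto_pi_nhds.2 fun ω =>
        tendsto_nhds_of_eventually_eq (hM.arrivals.eventually_gridCeil_eq ω _))
  exact (h (k + 1)).sub (h k)

/-- By independence the service times may be frozen (Fubini); the epochs are then deterministic and
nondecreasing, and the Poisson increments factor. -/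
lemma IsMGIInput.measure_grid_arrivals [IsProbabilityMeasure P]
    (hM : IsMGIInput P lam B N χ) (h0 : B (Iio 0) = 0)
    (M T : ℕ) (x : ℕ → ℕ) :
    P {ω | ∀ j < T, N (gridCeil M (epoch χ (j + 1) ω)) ω - N (gridCeil M (epoch χ j ω)) ω = x j} =
      ∫⁻ ω, ∏ j ∈ Finset.range T, poissonMeasure
        (lam * (gridCeil M (epoch χ (j + 1) ω) - gridCeil M (epoch χ j ω))) {x j} ∂P := by
  have hN : Measurable fun ω t => N t ω := measurable_pi_lambda _ hM.arrivals.measurable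
  have hχ : Measurable fun ω i => χ i ω := measurable_pi_lambda _ hM.measurable_service
  have hep : ∀ k, Measurable (epoch (fun i (c : ℕ → ℝ) => c i) k) :=
    measurable_epoch fun i => measurable_pi_apply i
  let A : Set ((ℝ≥0 → ℕ) × (ℕ → ℝ)) := {z | ∀ j < T,
    z.1 (gridCeil M (epoch (fun i (c : ℕ → ℝ) => c i) (j + 1) z.2)) -
      z.1 (gridCeil M (epoch (fun i (c : ℕ → ℝ) => c i) j z.2)) = x j}
  have hA : MeasurableSet A := by
    have hm : ∀ k, Measurable fun z : (ℝ≥0 → ℕ) × (ℕ → ℝ) =>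
        z.1 (gridCeil M (epoch (fun i (c : ℕ → ℝ) => c i) k z.2)) := fun k =>
      measurable_eval_gridCeil M measurable_fst ((hep k).comp measurable_snd)
    have : A = ⋂ j, ⋂ _ : j < T, (fun z : (ℝ≥0 → ℕ) × (ℕ → ℝ) =>
        z.1 (gridCeil M (epoch (fun i (c : ℕ → ℝ) => c i) (j + 1) z.2)) -
          z.1 (gridCeil M (epoch (fun i (c : ℕ → ℝ) => c i) j z.2))) ⁻¹' {x j} := by
      ext; simp [A]
    rw [this]
    exact .iInter fun j => .iInter fun _ => ((hm (j + 1)).sub (hm j)) .of_discrete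
  have h1 : P {ω | ∀ j < T, N (gridCeil M (epoch χ (j + 1) ω)) ω -
      N (gridCeil M (epoch χ j ω)) ω = x j} =
      P.map (fun ω => ((fun t => N t ω), fun i => χ i ω)) A := by
    rw [Measure.map_apply (hN.prodMk hχ) hA]
    rfl
  have hprob := Measure.isProbabilityMeasure_map (μ := P) hN.aemeasurable
  have hprob' := Measure.isProbabilityMeasure_map (μ := P) hχ.aemeasurable
  rw [h1, hM.indep.map_prod_eq_prod_map_map hN.aemeasurable hχ.aemeasurable,
    Measure.prod_apply_symm hA, lintegral_map (measurable_measure_prodMk_right hA) hχ]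
  refine lintegral_congr_ae ?_
  filter_upwards [hM.ae_nonneg h0] with ω hω
  rw [Measure.map_apply hN (measurable_prodMk_right hA)]
  exact hM.arrivals.measure_increments
    (s := fun j => gridCeil M (epoch χ j ω)) ((monotone_gridCeil M).comp (epoch_mono hω)) T x

lemma continuous_poissonMeasure_singleton (k : ℕ) :
    Continuous fun r : ℝ≥0 => poissonMeasure r {k} := by
  simp_rw [poissonMeasure_singleton]
  exact ENNReal.continuous_ofReal.comp (by fun_prop)

/-- The grid is refined. By right continuity the indicators on the left are eventually constant, and
on the right dominated convergence replaces grid increments by service times, whose independence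
splits the product. -/
lemma IsMGIInput.measure_arrivalsDuring [IsProbabilityMeasure P]
    (hM : IsMGIInput P lam B N χ) (h0 : B (Iio 0) = 0)
    (T : ℕ) (x : ℕ → ℕ) :
    P {ω | ∀ j < T, arrivalsDuring N χ ω j = x j} =
      ∏ j ∈ Finset.range T, arrivalLaw lam B {x j} := by
  have hN : Measurable fun ω t => N t ω := measurable_pi_lambda _ hM.arrivals.measurable
  have hep := measurable_epoch hM.measurable_service
  have hgrid : ∀ M, Measurable (gridCeil M) := fun M => (monotone_gridCeil M).measurable
  let E : ℕ → Set Ω := fun M => {ω | ∀ j < T,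
    N (gridCeil M (epoch χ (j + 1) ω)) ω - N (gridCeil M (epoch χ j ω)) ω = x j}
  have hE : ∀ M, MeasurableSet (E M) := fun M => by
    have hm : ∀ k, Measurable fun ω => N (gridCeil M (epoch χ k ω)) ω := fun k =>
      measurable_eval_gridCeil M hN (hep k)
    have : E M = ⋂ j, ⋂ _ : j < T, (fun ω =>
        N (gridCeil M (epoch χ (j + 1) ω)) ω - N (gridCeil M (epoch χ j ω)) ω) ⁻¹' {x j} := by
      ext; simp [E]
    rw [this]
    exact .iInter fun j => .iInter fun _ => ((hm (j + 1)).sub (hm j)) .of_discrete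
  have hE' : MeasurableSet {ω | ∀ j < T, arrivalsDuring N χ ω j = x j} := by
    have : {ω | ∀ j < T, arrivalsDuring N χ ω j = x j} =
        ⋂ j, ⋂ _ : j < T, (fun ω => arrivalsDuring N χ ω j) ⁻¹' {x j} := by
      ext; simp
    rw [this]
    exact .iInter fun j => .iInter fun _ => hM.measurable_arrivalsDuring j .of_discrete
  have hlim : Tendsto (fun M => P (E M)) atTop
      (𝓝 (P {ω | ∀ j < T, arrivalsDuring N χ ω j = x j})) := by
    refine tendsto_measure_of_tendsto_indicator_of_isFiniteMeasure atTop _ hE fun ω => ?_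
    have h : ∀ᶠ M in atTop, ∀ k ∈ Finset.range (T + 1),
        N (gridCeil M (epoch χ k ω)) ω = N (epoch χ k ω) ω :=
      (Finset.eventually_all _).2 fun k _ => hM.arrivals.eventually_gridCeil_eq ω _
    filter_upwards [h] with M hMω
    refine forall₂_congr fun j hj => ?_
    rw [hMω (j + 1) (by simpa using hj), hMω j (by simp; omega), arrivalsDuring]
  have hpois : Tendsto (fun M => P (E M)) atTop
      (𝓝 (∫⁻ ω, ∏ j ∈ Finset.range T, poissonMeasure (lam * (χ j ω).toNNReal) {x j} ∂P)) := by
    simp_rw [E, hM.measure_grid_arrivals h0]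
    refine tendsto_lintegral_of_dominated_convergence (fun _ => 1) (fun M => ?_) (fun M => ?_)
      (by simp) ?_
    · refine Finset.measurable_fun_prod _ fun j _ => ?_
      exact (measurable_poissonMeasure_apply _).comp
        ((((hgrid M).comp (hep (j + 1))).sub ((hgrid M).comp (hep j))).const_mul _)
    · exact .of_forall fun ω => Finset.prod_le_one' fun j _ => prob_le_one
    · filter_upwards [hM.ae_nonneg h0] with ω hω
      refine ENNReal.tendsto_finsetProd_of_ne_top _ (fun j _ => ?_)
        fun j _ => measure_ne_top _ _
      rw [← epoch_succ_sub hω j]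
      have ht : ∀ k, Tendsto (fun M => gridCeil M (epoch χ k ω)) atTop (𝓝 (epoch χ k ω)) :=
        fun k => (tendsto_nhdsWithin_iff.1 (tendsto_gridCeil _)).1
      exact ((continuous_poissonMeasure_singleton (x j)).tendsto _).comp
        (((ht (j + 1)).sub (ht j)).const_mul lam)
  rw [tendsto_nhds_unique hlim hpois]
  have hmeas : ∀ k : ℕ, Measurable fun t : ℝ => poissonMeasure (lam * t.toNNReal) {k} := fun k =>
    (measurable_poissonMeasure_apply _).comp (by fun_prop)
  rw [lintegral_prod_eq_prod_lintegral_of_indepFun _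
    (fun j ω => poissonMeasure (lam * (χ j ω).toNNReal) {x j})
    (hM.service_indep.comp _ fun j => hmeas (x j))
    fun j => (hmeas (x j)).comp (hM.measurable_service j)]
  refine Finset.prod_congr rfl fun j _ => ?_
  rw [arrivalLaw_apply, ← hM.service_law j, lintegral_map (hmeas _) (hM.measurable_service j)]

/-! ### From independent arrival counts to a Markov chain. -/

lemma busyState_congr (n : ℕ) {a a' : ℕ → ℕ} {t : ℕ} (h : ∀ j < t, a j = a' j) :
    busyState n a t = busyState n a' t := by
  induction t with
  | zero => rfl
  | succ t ih => rw [busyState, busyState, ih fun j hj => h j (by omega), h t (by omega)]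

/-- The state of the queue after service completions is a Markov chain. -/
lemma IsMGIInput.lintegral_busyState_succ [IsProbabilityMeasure P]
    (hM : IsMGIInput P lam B N χ) (h0 : B (Iio 0) = 0)
    (n t : ℕ) (f : ℕ × ℕ → ℝ≥0∞) :
    ∫⁻ ω, f (busyState n (arrivalsDuring N χ ω) (t + 1)) ∂P =
      ∫⁻ ω, ∑' a, arrivalLaw lam B {a} *
        f (serviceStep n (busyState n (arrivalsDuring N χ ω) t) a) ∂P := by
  have hB : IsProbabilityMeasure B := by
    rw [← hM.service_law 0]
    exact Measure.isProbabilityMeasure_map (hM.measurable_service 0).aemeasurable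
  have ha := hM.measurable_arrivalsDuring
  -- The padding value 0 is never read: the state after t services depends on the first t counts
  -- only.
  let ext : (Fin t → ℕ) → ℕ → ℕ := fun x j => if h : j < t then x ⟨j, h⟩ else 0
  let V : Ω → Fin t → ℕ := fun ω j => arrivalsDuring N χ ω j
  have hV : Measurable V := measurable_pi_lambda _ fun j => ha j
  have hstate : ∀ ω, busyState n (arrivalsDuring N χ ω) t = busyState n (ext (V ω)) t := fun ω =>
    busyState_congr n fun j hj => by simp [ext, V, hj]
  have hV1 : ∀ x, P.map V {x} = ∏ j ∈ Finset.range t, arrivalLaw lam B {ext x j} := fun x => by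
    rw [← hM.measure_arrivalsDuring h0, Measure.map_apply hV (measurableSet_singleton x)]
    congr 1 with ω
    simp only [mem_preimage, mem_singleton_iff, mem_ofPred_eq, funext_iff, V, Fin.forall_iff]
    exact forall₂_congr fun j hj => by simp [ext, hj]
  have hV2 : ∀ z : (Fin t → ℕ) × ℕ, P.map (fun ω => (V ω, arrivalsDuring N χ ω t)) {z} =
      P.map V {z.1} * arrivalLaw lam B {z.2} := fun z => by
    have h := hM.measure_arrivalsDuring h0 (t + 1) (fun j => if j < t then ext z.1 j else z.2)
    rw [Finset.prod_range_succ, if_neg (lt_irrefl t)] at h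
    have hp : ∏ j ∈ Finset.range t, arrivalLaw lam B {ext z.1 j} =
        ∏ j ∈ Finset.range t, arrivalLaw lam B {if j < t then ext z.1 j else z.2} :=
      Finset.prod_congr rfl fun j hj => by rw [if_pos (Finset.mem_range.1 hj)]
    rw [hV1, hp, ← h,
      Measure.map_apply (hV.prodMk (ha t)) (measurableSet_singleton z)]
    congr 1 with ω
    simp only [mem_preimage, mem_singleton_iff, mem_ofPred_eq, Prod.ext_iff, funext_iff, V,
      Fin.forall_iff, Nat.forall_lt_succ_right, lt_irrefl, if_false]
    refine and_congr (forall₂_congr fun j hj => ?_) Iff.rfl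
    simp [ext, hj]
  calc _ = ∫⁻ ω, f (serviceStep n (busyState n (ext (V ω)) t) (arrivalsDuring N χ ω t)) ∂P := by
        simp_rw [busyState, hstate]
    _ = ∫⁻ z, f (serviceStep n (busyState n (ext z.1) t) z.2)
          ∂P.map (fun ω => (V ω, arrivalsDuring N χ ω t)) :=
        (lintegral_map (f := fun z : (Fin t → ℕ) × ℕ =>
          f (serviceStep n (busyState n (ext z.1) t) z.2)) (measurable_of_countable _)
          (hV.prodMk (ha t))).symm
    _ = ∑' x, ∑' a, f (serviceStep n (busyState n (ext x) t) a) *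
          (P.map V {x} * arrivalLaw lam B {a}) := by
        rw [lintegral_countable', ENNReal.tsum_prod']
        simp_rw [hV2]
    _ = ∫⁻ x, ∑' a, arrivalLaw lam B {a} * f (serviceStep n (busyState n (ext x) t) a)
          ∂P.map V := by
        rw [lintegral_countable']
        refine tsum_congr fun x => ?_
        rw [← ENNReal.tsum_mul_right]
        exact tsum_congr fun a => by ring
    _ = _ := by
        rw [lintegral_map (measurable_of_countable _) hV]
        simp_rw [hstate]

end

/-! ### Expectations under laws on `ℕ` -/

/-- The expectation of `f` under the law `μ`. -/
noncomputable def expect (μ : PMF ℕ) (f : ℕ → ℝ≥0∞) : ℝ≥0∞ := ∑' x, μ x * f x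

lemma expect_mono (μ : PMF ℕ) {f g : ℕ → ℝ≥0∞} (h : ∀ x, f x ≤ g x) : expect μ f ≤ expect μ g :=
  ENNReal.tsum_le_tsum fun x => mul_le_mul' le_rfl (h x)

lemma expect_const (μ : PMF ℕ) (c : ℝ≥0∞) : expect μ (fun _ => c) = c := by
  rw [expect, ENNReal.tsum_mul_right, μ.tsum_coe, one_mul]

lemma expect_pure (a : ℕ) (f : ℕ → ℝ≥0∞) : expect (PMF.pure a) f = f a := by
  rw [expect, tsum_eq_single a fun b hb => by simp [hb]]
  simp

lemma expect_bind (μ : PMF ℕ) (κ : ℕ → PMF ℕ) (f : ℕ → ℝ≥0∞) :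
    expect (μ.bind κ) f = expect μ fun x => expect (κ x) f := by
  simp only [expect, PMF.bind_apply, ← ENNReal.tsum_mul_right, ← ENNReal.tsum_mul_left]
  rw [ENNReal.tsum_comm]
  simp_rw [mul_assoc]

lemma expect_map (μ : PMF ℕ) (g : ℕ → ℕ) (f : ℕ → ℝ≥0∞) :
    expect (μ.map g) f = expect μ fun x => f (g x) := by
  rw [← PMF.bind_pure_comp, expect_bind]
  simp [expect_pure]

lemma expect_comm (μ ν : PMF ℕ) (f : ℕ → ℕ → ℝ≥0∞) :
    (expect μ fun x => expect ν fun y => f x y) = expect ν fun y => expect μ fun x => f x y := by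
  simp only [expect, ← ENNReal.tsum_mul_left]
  rw [ENNReal.tsum_comm]
  refine tsum_congr fun y => tsum_congr fun x => ?_
  ring

lemma ext_of_expect {μ ν : PMF ℕ} (h : ∀ f, expect μ f = expect ν f) : μ = ν := by
  ext a
  have key : ∀ ρ : PMF ℕ, expect ρ (({a} : Set ℕ).indicator 1) = ρ a := fun ρ => by
    rw [expect, tsum_eq_single a fun b hb => by simp [hb]]
    simp
  rw [← key, ← key, h]

lemma toMeasure_Ici (μ : PMF ℕ) (m : ℕ) :
    μ.toMeasure (Ici m) = expect μ ((Ici m).indicator 1) := by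
  rw [PMF.toMeasure_apply (hs := .of_discrete), expect]
  refine tsum_congr fun x => ?_
  by_cases hx : x ∈ Ici m <;> simp [hx]

/-- The law of the sum of independent variables with laws `μ` and `ν`. -/
noncomputable def conv (μ ν : PMF ℕ) : PMF ℕ := μ.bind fun s => ν.map fun x => s + x

lemma expect_conv (μ ν : PMF ℕ) (f : ℕ → ℝ≥0∞) :
    expect (conv μ ν) f = expect μ fun s => expect ν fun x => f (s + x) := by
  simp [conv, expect_bind, expect_map]

lemma iidSum_succ (ν : PMF ℕ) (k : ℕ) : iidSum ν (k + 1) = conv (iidSum ν k) ν := rfl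

lemma expect_iidSum_add (ν : PMF ℕ) (j k : ℕ) (f : ℕ → ℝ≥0∞) :
    expect (iidSum ν (j + k)) f =
      expect (iidSum ν j) fun s => expect (iidSum ν k) fun x => f (s + x) := by
  induction k generalizing f with
  | zero => simp [iidSum, expect_pure]
  | succ k ih =>
    rw [← add_assoc, iidSum_succ, expect_conv, ih]
    simp only [iidSum_succ, expect_conv, add_assoc]

lemma iidSum_bind_iidSum (ν ς : PMF ℕ) (k : ℕ) :
    (iidSum ν k).bind (iidSum ς) = iidSum (randomSum ν ς) k := by
  refine ext_of_expect fun f => ?_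
  induction k generalizing f with
  | zero => simp [iidSum, expect_pure]
  | succ k ih =>
    simp only [expect_bind] at ih
    simp only [iidSum_succ, expect_bind, expect_conv, expect_iidSum_add, randomSum]
    rw [← randomSum, ← ih]
    refine congrArg _ (funext fun s => ?_)
    rw [expect_comm]

/-- The last generation is absorbed into the summands: each member of generation n carries an
independent `randomSum ν ς`. -/
lemma randomSum_galtonWatson (ν ς : PMF ℕ) (n : ℕ) :
    randomSum (galtonWatson ν n) ς = (randomSum ν)^[n] ς := by
  induction n generalizing ς with
  | zero =>
    refine ext_of_expect fun f => ?_
    simp [randomSum, galtonWatson, iidSum, expect_map]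
  | succ n ih =>
    rw [Function.iterate_succ_apply, ← ih, randomSum, galtonWatson, PMF.bind_bind, randomSum]
    simp_rw [iidSum_bind_iidSum]

/-! ### Monotone functions and tails -/

lemma eq_tsum_increments (f : ℕ → ℝ≥0∞) (hf : Monotone f) (a : ℕ) :
    f a = f 0 + ∑' j, (f (j + 1) - f j) * (Ici (j + 1)).indicator 1 a := by
  have h : ∑' j, (f (j + 1) - f j) * (Ici (j + 1)).indicator 1 a =
      ∑ j ∈ Finset.range a, (f (j + 1) - f j) := by
    rw [tsum_eq_sum (s := Finset.range a) fun j hj => ?_]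
    · refine Finset.sum_congr rfl fun j hj => ?_
      have : j + 1 ≤ a := Finset.mem_range.1 hj
      simp [this]
    · have : ¬ j + 1 ≤ a := fun h => hj (Finset.mem_range.2 h)
      simp [this]
  rw [h]
  clear h
  induction a with
  | zero => simp
  | succ a ih => rw [Finset.sum_range_succ, ← add_assoc, ← ih, add_tsub_cancel_of_le (hf a.le_succ)]

/-- Summation by parts writes a monotone f as a nonnegative combination of tail indicators. The
weights are not normalised, so m = 0 is needed to compare total masses. -/
lemma tsum_mul_le_of_tails {u v f : ℕ → ℝ≥0∞} (hf : Monotone f)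
    (h : ∀ m, ∑' a, u a * (Ici m).indicator 1 a ≤ ∑' a, v a * (Ici m).indicator 1 a) :
    ∑' a, u a * f a ≤ ∑' a, v a * f a := by
  have key : ∀ w : ℕ → ℝ≥0∞, ∑' a, w a * f a = (∑' a, w a * (Ici 0).indicator 1 a) * f 0 +
      ∑' j, (f (j + 1) - f j) * ∑' a, w a * (Ici (j + 1)).indicator 1 a := fun w => by
    simp_rw [← ENNReal.tsum_mul_left]
    rw [ENNReal.tsum_comm, ← ENNReal.tsum_mul_right, ← ENNReal.tsum_add]
    refine tsum_congr fun a => ?_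
    conv_lhs => rw [eq_tsum_increments f hf a, mul_add, ← ENNReal.tsum_mul_left]
    congr 1
    · simp
    · exact tsum_congr fun j => by ring
  rw [key, key]
  refine add_le_add (mul_le_mul' (h 0) le_rfl) (ENNReal.tsum_le_tsum fun j => ?_)
  exact mul_le_mul' le_rfl (h _)

lemma tsum_singleton_add_mul_indicator (β : Measure ℕ) (i m : ℕ) :
    ∑' a, β {i + a} * (Ici m).indicator 1 a = β (Ici (i + m)) := by
  have h := (add_right_injective i).tsum_eq (f := (Ici (i + m)).indicator fun x => β {x})
    fun a ha => ⟨a - i, by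
      have : i + m ≤ a := indicator_apply_ne_zero.1 ha |>.1
      simp; omega⟩
  rw [← Measure.tsum_indicator_apply_singleton β _ (MeasurableSet.of_discrete (s := Ici (i + m))),
    ← h]
  refine tsum_congr fun a => ?_
  by_cases h : m ≤ a <;> simp [h]

/-- At most a fraction r of the mass t sits on the smaller value x; moving mass from y to x until
the fraction is exactly r lowers the sum. -/
lemma mix_le {s t u r x y : ℝ≥0∞} (ht : s + u = t) (hs : s ≤ r * t) (hs' : s ≠ ∞) (hr : r ≤ 1)
    (hxy : x ≤ y) : t * (r * x + (1 - r) * y) ≤ s * x + u * y := by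
  obtain ⟨δ, hδ⟩ := exists_add_of_le hs
  have hu : u = δ + (1 - r) * t := by
    refine (ENNReal.add_right_inj hs').1 ?_
    rw [ht, ← add_assoc, ← hδ, ← add_mul, add_tsub_cancel_of_le hr, one_mul]
  calc t * (r * x + (1 - r) * y) = (s + δ) * x + (1 - r) * t * y := by rw [← hδ]; ring
    _ = s * x + (δ * x + (1 - r) * t * y) := by ring
    _ ≤ s * x + (δ * y + (1 - r) * t * y) := by gcongr
    _ = s * x + u * y := by rw [hu]; ring

/-! ### Losses generated by an upcrossing -/

section

variable {ν γ ς : PMF ℕ} {r b : ℝ≥0∞}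

/-- If `ν` is the law of a variable that vanishes with probability `r`, and otherwise exceeds by
one a variable with law `γ`, then random sums decompose along the first summand. -/
lemma expect_randomSum (hν : ∀ f, expect ν f = r * f 0 + (1 - r) * expect γ fun k => f (k + 1))
    (κ : PMF ℕ) (f : ℕ → ℝ≥0∞) :
    expect (randomSum ν κ) f =
      r * f 0 + (1 - r) * expect κ fun s => expect (randomSum γ κ) fun x => f (s + x) := by
  rw [randomSum, expect_bind, hν]
  congr 2
  · simp [iidSum, expect_pure]
  · simp only [iidSum_succ, expect_conv, randomSum, expect_bind]
    rw [expect_comm]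
    refine congrArg _ (funext fun k => ?_)
    rw [expect_comm]
    simp_rw [add_comm]

/-- A lower bound for the law of the losses between the start of a service with room for `k`
further customers and the first moment with room for `k + 1`. -/
noncomputable def freshLaw (ν γ ς : PMF ℕ) : ℕ → PMF ℕ
  | 0 => ς
  | k + 1 => randomSum γ ((randomSum ν)^[k] ς)

/-- A lower bound for the law of the losses, in the setting of `freshLaw`, when `a` customers
arrive during the first service. -/
noncomputable def serviceLossLaw (ν γ ς : PMF ℕ) : ℕ → ℕ → PMF ℕ
  | 0, a => PMF.pure a
  | _ + 1, 0 => PMF.pure 0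
  | k + 1, a + 1 => conv (serviceLossLaw ν γ ς k a) (freshLaw ν γ ς (k + 1))

lemma tsum_serviceLossLaw_succ (β : Measure ℕ) (k i : ℕ) (f : ℕ → ℝ≥0∞) :
    ∑' a, β {i + a} * expect (serviceLossLaw ν γ ς (k + 1) a) f = β {i} * f 0 +
      ∑' a, β {i + 1 + a} * expect (serviceLossLaw ν γ ς k a) fun s =>
        expect (freshLaw ν γ ς (k + 1)) fun x => f (s + x) := by
  rw [tsum_eq_zero_add' ENNReal.summable]
  congr 1
  · simp [serviceLossLaw, expect_pure]
  · refine tsum_congr fun a => ?_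
    rw [serviceLossLaw, expect_conv, add_right_comm, add_assoc]

lemma monotone_expect_add {f : ℕ → ℝ≥0∞} (hf : Monotone f) (μ : PMF ℕ) :
    Monotone fun s => expect μ fun x => f (s + x) :=
  fun _ _ h => expect_mono _ fun _ => hf (by omega)

lemma le_expect_expect {f : ℕ → ℝ≥0∞} (hf : Monotone f) (μ κ : PMF ℕ) :
    f 0 ≤ expect κ fun s => expect μ fun x => f (s + x) := by
  calc f 0 = expect κ fun _ => expect μ fun _ => f 0 := by simp [expect_const]
    _ ≤ _ := expect_mono _ fun s => expect_mono _ fun x => hf (by omega)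

/-! ### Comparison of upcrossing losses with arrival counts. -/

variable {β : Measure ℕ}

lemma measure_Ici_mul_expect_le
    (htail : ∀ i m, β (Ici i) * ς.toMeasure (Ici m) ≤ β (Ici (i + m))) (i : ℕ)
    {f : ℕ → ℝ≥0∞} (hf : Monotone f) : β (Ici i) * expect ς f ≤ ∑' a, β {i + a} * f a := by
  rw [expect, ← ENNReal.tsum_mul_left]
  simp_rw [← mul_assoc]
  refine tsum_mul_le_of_tails hf fun m => ?_
  rw [tsum_singleton_add_mul_indicator]
  refine le_trans (le_of_eq ?_) (htail i m)
  rw [toMeasure_Ici, expect, ← ENNReal.tsum_mul_left]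
  exact tsum_congr fun a => by ring

/-- The current service has already seen i arrivals and there is room for k more. Either it sees no
other, which has conditional probability at most r, or the next arrival raises i and lowers k;
`mix_le` replaces the true probability by r. -/
lemma measure_Ici_mul_expect_iterate_le [IsProbabilityMeasure β] (hr : r ≤ 1)
    (hν : ∀ f, expect ν f = r * f 0 + (1 - r) * expect γ fun k => f (k + 1))
    (hzero : ∀ i, β {i} ≤ r * β (Ici i))
    (htail : ∀ i m, β (Ici i) * ς.toMeasure (Ici m) ≤ β (Ici (i + m)))
    (k i : ℕ) {f : ℕ → ℝ≥0∞} (hf : Monotone f) :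
    β (Ici i) * expect ((randomSum ν)^[k] ς) f ≤
      ∑' a, β {i + a} * expect (serviceLossLaw ν γ ς k a) f := by
  induction k generalizing i f with
  | zero => simpa [serviceLossLaw, expect_pure] using measure_Ici_mul_expect_le htail i hf
  | succ k ih =>
    rw [Function.iterate_succ_apply', expect_randomSum hν, tsum_serviceLossLaw_succ]
    refine (mix_le (measure_Ici_eq_add β i) (hzero i) (measure_ne_top _ _) hr
      (le_expect_expect hf _ _)).trans (add_le_add le_rfl ?_)
    exact ih (i + 1) (monotone_expect_add hf _)

/-- A fresh service has no arrivals with probability exactly b, matching the recursion of γ, so only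
the part after the first arrival (i = 1) is estimated. -/
lemma expect_freshLaw_le [IsProbabilityMeasure β] (hr : r ≤ 1)
    (hν : ∀ f, expect ν f = r * f 0 + (1 - r) * expect γ fun k => f (k + 1))
    (hγ : ∀ f, expect γ f = β {0} * f 0 + (1 - β {0}) * expect γ fun k => f (k + 1))
    (hzero : ∀ i, β {i} ≤ r * β (Ici i))
    (htail : ∀ i m, β (Ici i) * ς.toMeasure (Ici m) ≤ β (Ici (i + m)))
    (k : ℕ) {f : ℕ → ℝ≥0∞} (hf : Monotone f) :
    expect (freshLaw ν γ ς k) f ≤ ∑' a, β {a} * expect (serviceLossLaw ν γ ς k a) f := by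
  have huniv : (Ici 0 : Set ℕ) = univ := by ext; simp
  rcases k with _ | k
  · have := measure_Ici_mul_expect_le htail 0 hf
    simpa [serviceLossLaw, expect_pure, huniv, freshLaw] using this
  · have h := tsum_serviceLossLaw_succ (ν := ν) (γ := γ) (ς := ς) β k 0 f
    simp only [zero_add] at h
    have h1 : (1 : ℝ≥0∞) - β {0} = β (Ici 1) := by
      rw [← prob_compl_eq_one_sub .of_discrete]
      congr 1
      ext; simp; omega
    rw [h, freshLaw, expect_randomSum hγ, h1]
    gcongr
    exact measure_Ici_mul_expect_iterate_le hr hν hzero htail k 1 (monotone_expect_add hf _)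

/-- The two laws differ only in the mass at which the first trial fails, r against b ≤ r. -/
lemma expect_iterate_le_freshLaw (hr : r ≤ 1) (hbr : b ≤ r)
    (hν : ∀ f, expect ν f = r * f 0 + (1 - r) * expect γ fun k => f (k + 1))
    (hγ : ∀ f, expect γ f = b * f 0 + (1 - b) * expect γ fun k => f (k + 1))
    (k : ℕ) {f : ℕ → ℝ≥0∞} (hf : Monotone f) :
    expect ((randomSum ν)^[k] ς) f ≤ expect (freshLaw ν γ ς k) f := by
  rcases k with _ | k
  · rfl
  · rw [Function.iterate_succ_apply', expect_randomSum hν, freshLaw, expect_randomSum hγ]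
    have hb1 : b ≤ 1 := hbr.trans hr
    have := mix_le (add_tsub_cancel_of_le hb1) (by simpa using hbr)
      (ne_top_of_le_ne_top ENNReal.one_ne_top hb1) hr
      (le_expect_expect hf (randomSum γ ((randomSum ν)^[k] ς)) ((randomSum ν)^[k] ς))
    simpa using this

/-! ### Losses until the end of the busy period -/

/-- A lower bound for the law of the losses until the end of the busy period, when a service
begins with `q` customers in the system. -/
noncomputable def remainingLaw (ν γ ς : PMF ℕ) (n : ℕ) : ℕ → PMF ℕ
  | 0 => PMF.pure 0
  | q + 1 => conv (remainingLaw ν γ ς n q) (freshLaw ν γ ς (n - q))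

/-- A lower bound for the expectation of `f` at the number of losses in the busy period, given the
current state. -/
noncomputable def value (ν γ ς : PMF ℕ) (n : ℕ) (f : ℕ → ℝ≥0∞) (s : ℕ × ℕ) : ℝ≥0∞ :=
  expect (remainingLaw ν γ ς n s.1) fun y => f (s.2 + y)

lemma serviceStep_zero (n q l : ℕ) : serviceStep n (q + 1, l) 0 = (q, l) := by simp [serviceStep]

lemma serviceStep_succ (n q l a : ℕ) :
    serviceStep n (q + 1, l) (a + 1) = serviceStep n (arrivalStep n (q + 1, l)) a := by
  have : (arrivalStep n (q + 1, l)).1 ≠ 0 := by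
    unfold arrivalStep
    split_ifs <;> simp
  rw [serviceStep, serviceStep, if_neg (Nat.succ_ne_zero q), if_neg this,
    Function.iterate_succ_apply]

/-- An admitted arrival adds the same `freshLaw` summand to the remaining law and to
`serviceLossLaw`; with no room left it adds one to the loss counter instead. -/
lemma value_serviceStep (n : ℕ) (f : ℕ → ℝ≥0∞) (a : ℕ) {q : ℕ} (hq : q ≤ n) (l : ℕ) :
    value ν γ ς n f (serviceStep n (q + 1, l) a) =
      expect (serviceLossLaw ν γ ς (n - q) a) fun s =>
        expect (remainingLaw ν γ ς n q) fun y => f (l + s + y) := by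
  induction a generalizing q l with
  | zero =>
    rw [serviceStep_zero, value]
    rcases n - q with _ | k <;> simp [serviceLossLaw, expect_pure]
  | succ a ih =>
    rw [serviceStep_succ, arrivalStep]
    rcases hq.eq_or_lt with rfl | hlt
    · rw [if_pos rfl, ih le_rfl]
      simp [serviceLossLaw, expect_pure, add_assoc, add_comm 1]
    · have hk : n - q = n - (q + 1) + 1 := by omega
      rw [if_neg (by simp; omega), ih hlt]
      simp only [remainingLaw]
      rw [hk, serviceLossLaw, expect_conv]
      refine congrArg _ (funext fun s => ?_)
      rw [expect_conv, expect_comm]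
      simp only [add_comm, add_left_comm]

/-- The submartingale property of `value`. Only the losses until the number in the system first
drops below its present level need an estimate; the empty state is absorbing. -/
lemma value_le_tsum [IsProbabilityMeasure β] (hr : r ≤ 1)
    (hν : ∀ f, expect ν f = r * f 0 + (1 - r) * expect γ fun k => f (k + 1))
    (hγ : ∀ f, expect γ f = β {0} * f 0 + (1 - β {0}) * expect γ fun k => f (k + 1))
    (hzero : ∀ i, β {i} ≤ r * β (Ici i))
    (htail : ∀ i m, β (Ici i) * ς.toMeasure (Ici m) ≤ β (Ici (i + m)))
    {n : ℕ} {f : ℕ → ℝ≥0∞} (hf : Monotone f) {s : ℕ × ℕ} (hs : s.1 ≤ n + 1) :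
    value ν γ ς n f s ≤ ∑' a, β {a} * value ν γ ς n f (serviceStep n s a) := by
  obtain ⟨q, l⟩ := s
  rcases q with _ | q
  · have h1 : ∑' a, β {a} = 1 := by
      have := tsum_singleton_add_mul_indicator β 0 0
      simpa [show (Ici 0 : Set ℕ) = univ by ext; simp] using this
    simp [serviceStep, ENNReal.tsum_mul_right, h1]
  · have hq : q ≤ n := by simpa using hs
    simp_rw [value_serviceStep n f _ hq]
    rw [value]
    simp only [remainingLaw]
    rw [expect_conv, expect_comm]
    refine le_trans (le_of_eq ?_) (expect_freshLaw_le hr hν hγ hzero htail (n - q)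
      (f := fun s => expect (remainingLaw ν γ ς n q) fun y => f (l + s + y)) ?_)
    · simp only [add_comm, add_left_comm]
    · exact fun _ _ h => expect_mono _ fun _ => hf (by omega)

/-! ### The busy period ends -/

lemma iterate_arrivalStep_fst_le {n : ℕ} (a : ℕ) {s : ℕ × ℕ} (hs : s.1 ≤ n + 1) :
    ((arrivalStep n)^[a] s).1 ≤ n + 1 := by
  induction a generalizing s with
  | zero => exact hs
  | succ a ih =>
    rw [Function.iterate_succ_apply]
    refine ih ?_
    unfold arrivalStep
    split_ifs with h
    · exact hs
    · simp; omega

lemma busyState_fst_le (n : ℕ) (a : ℕ → ℕ) (t : ℕ) : (busyState n a t).1 ≤ n + 1 := by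
  induction t with
  | zero => simp [busyState]
  | succ t ih =>
    rw [busyState, serviceStep]
    split_ifs
    · exact ih
    · have := iterate_arrivalStep_fst_le (a t) ih
      simp; omega

/-- A Lyapunov function for the number in the system at the ends of services. -/
lemma tsum_lyapunov_le [IsProbabilityMeasure β] {θ : ℝ} (hθ0 : 0 ≤ θ) (hθ1 : θ ≤ 1)
    (hθ : 2 * θ = (β {0}).toReal) {n : ℕ} {s : ℕ × ℕ} (hs : s.1 ≤ n + 1) :
    ∑' a, β {a} * ENNReal.ofReal (1 - θ ^ (serviceStep n s a).1) ≤
      ENNReal.ofReal (1 - θ ^ (n + 1)) * ENNReal.ofReal (1 - θ ^ s.1) := by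
  obtain ⟨q, l⟩ := s
  rcases q with _ | q
  · simp [serviceStep]
  have hq : q ≤ n := by simpa using hs
  have hpow : ∀ k, θ ^ k ≤ 1 := fun k => pow_le_one₀ hθ0 hθ1
  have h0 : β {0} = ENNReal.ofReal (2 * θ) := by
    rw [hθ, ENNReal.ofReal_toReal (measure_ne_top _ _)]
  have hb1 : 2 * θ ≤ 1 := by
    rw [hθ]
    exact ENNReal.toReal_mono ENNReal.one_ne_top prob_le_one
  have h1 : β (Ici 1) = ENNReal.ofReal (1 - 2 * θ) := by
    rw [ENNReal.ofReal_sub _ (by positivity), ← h0, ENNReal.ofReal_one,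
      ← prob_compl_eq_one_sub .of_discrete]
    congr 1
    ext; simp; omega
  have h2 : ∑' a, β {a + 1} = β (Ici 1) := by
    have := tsum_singleton_add_mul_indicator β 1 0
    simpa [show (Ici 0 : Set ℕ) = univ by ext; simp, add_comm] using this
  calc ∑' a, β {a} * ENNReal.ofReal (1 - θ ^ (serviceStep n (q + 1, l) a).1)
      ≤ β {0} * ENNReal.ofReal (1 - θ ^ q) + β (Ici 1) := by
        rw [tsum_eq_zero_add' ENNReal.summable, serviceStep_zero, ← h2]
        refine add_le_add le_rfl (ENNReal.tsum_le_tsum fun a => ?_)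
        refine mul_le_of_le_one_right' ?_
        rw [ENNReal.ofReal_le_one]
        linarith [pow_nonneg hθ0 (serviceStep n (q + 1, l) (a + 1)).1]
    -- The choice θ = b/2 gives bθ^q = 2θ^(q+1). One of these two powers is then bounded below by
    -- θ^(n+1), which yields the contraction.
    _ = ENNReal.ofReal (1 - 2 * θ ^ (q + 1)) := by
        rw [h0, h1, ← ENNReal.ofReal_mul (by positivity),
          ← ENNReal.ofReal_add (mul_nonneg (by positivity) (sub_nonneg.2 (hpow q))) (by linarith)]
        congr 1
        ring
    _ ≤ _ := by
        rw [← ENNReal.ofReal_mul (sub_nonneg.2 (hpow _))]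
        refine ENNReal.ofReal_le_ofReal ?_
        have h3 : θ ^ (n + 1) ≤ θ ^ (q + 1) := pow_le_pow_of_le_one hθ0 hθ1 (by omega)
        have h4 : 0 ≤ θ ^ (n + 1) * θ ^ (q + 1) := by positivity
        simp only
        nlinarith

end

/-! ### Modified geometric laws -/

/-- The weights of the law that gives mass `c` to `0` and is geometric with parameter `b` on the
positive integers. -/
noncomputable def modGeomWeight (c b : ℝ) : ℕ → ℝ
  | 0 => c
  | k + 1 => (1 - c) * (b * (1 - b) ^ k)

section

variable {c b : ℝ}

lemma modGeomWeight_nonneg (hc0 : 0 ≤ c) (hc1 : c ≤ 1) (hb0 : 0 < b) (hb1 : b ≤ 1) (m : ℕ) :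
    0 ≤ modGeomWeight c b m := by
  have := sub_nonneg.2 hc1
  have := sub_nonneg.2 hb1
  cases m <;> simp only [modGeomWeight] <;> positivity

lemma hasSum_modGeomWeight {𝕜 : Type*} [RCLike 𝕜] (hb0 : 0 < b) (hb1 : b ≤ 1) {z : 𝕜}
    (hz : ‖z‖ ≤ 1) : HasSum (fun m => (modGeomWeight c b m : 𝕜) * z ^ m)
      (c + (1 - c) * b * z * (1 - (1 - b) * z)⁻¹) := by
  have hnorm : ‖(1 - b : 𝕜) * z‖ < 1 := by
    have : ‖(1 - b : 𝕜)‖ = 1 - b := by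
      rw [← RCLike.ofReal_one, ← RCLike.ofReal_sub, RCLike.norm_ofReal,
        abs_of_nonneg (sub_nonneg.2 hb1)]
    rw [norm_mul, this]
    nlinarith [norm_nonneg z]
  have h := (hasSum_geometric_of_norm_lt_one hnorm).mul_left ((1 - c) * b * z : 𝕜)
  rw [← hasSum_nat_add_iff' 1]
  convert! h using 1
  · ext k
    simp only [modGeomWeight, mul_pow]
    push_cast
    ring
  · simp [modGeomWeight]

/-- The law that gives mass `c` to `0` and is geometric with parameter `b` on the positive
integers. -/
noncomputable def modGeom (c b : ℝ) (hc0 : 0 ≤ c) (hc1 : c ≤ 1) (hb0 : 0 < b) (hb1 : b ≤ 1) :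
    PMF ℕ :=
  ⟨fun m => ENNReal.ofReal (modGeomWeight c b m), by
    have h := hasSum_modGeomWeight (𝕜 := ℝ) (c := c) hb0 hb1 (z := 1) (by simp)
    have e : c + (1 - c) * b * 1 * (1 - (1 - b) * 1)⁻¹ = 1 := by
      have e : 1 - (1 - b) * 1 = b := by ring
      rw [e, mul_one, mul_assoc, mul_inv_cancel₀ hb0.ne']
      ring
    simp only [RCLike.ofReal_real_eq_id, id, one_pow, mul_one] at h e
    rw [e] at h
    rw [ENNReal.summable.hasSum_iff,
      ← ENNReal.ofReal_tsum_of_nonneg (modGeomWeight_nonneg hc0 hc1 hb0 hb1) h.summable, h.tsum_eq,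
      ENNReal.ofReal_one]⟩

variable (hc0 : 0 ≤ c) (hc1 : c ≤ 1) (hb0 : 0 < b) (hb1 : b ≤ 1)

lemma modGeom_apply (m : ℕ) :
    modGeom c b hc0 hc1 hb0 hb1 m = ENNReal.ofReal (modGeomWeight c b m) := rfl

lemma modGeom_self_apply (m : ℕ) :
    modGeom b b hb0.le hb1 hb0 hb1 m = ENNReal.ofReal (b * (1 - b) ^ m) := by
  rw [modGeom_apply]
  congr 1
  cases m <;> simp only [modGeomWeight] <;> ring

/-- Conditioned to be positive, the variable is one plus a geometric one. With c = b this is the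
lack of memory of γ, with c = r the recursion of ν. -/
lemma expect_modGeom (f : ℕ → ℝ≥0∞) :
    expect (modGeom c b hc0 hc1 hb0 hb1) f = ENNReal.ofReal c * f 0 +
      (1 - ENNReal.ofReal c) * expect (modGeom b b hb0.le hb1 hb0 hb1) fun k => f (k + 1) := by
  rw [expect, tsum_eq_zero_add' ENNReal.summable, expect, ← ENNReal.tsum_mul_left]
  congr 1
  refine tsum_congr fun k => ?_
  rw [modGeom_self_apply, modGeom_apply, modGeomWeight, ENNReal.ofReal_mul (sub_nonneg.2 hc1),
    ENNReal.ofReal_sub _ hc0, ENNReal.ofReal_one, mul_assoc]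

lemma pgf_modGeom_sub {𝕜 : Type*} [RCLike 𝕜] {z : 𝕜} (hz : ‖z‖ ≤ 1)
    (hne : (1 - z + z * b : 𝕜) ≠ 0) :
    pgf (modGeom c b hc0 hc1 hb0 hb1) z - b / (1 - z + z * b) =
      (c - b) * ((1 - z) / (1 - z + z * b)) := by
  have h : pgf (modGeom c b hc0 hc1 hb0 hb1) z = c + (1 - c) * b * z * (1 - (1 - b) * z)⁻¹ := by
    rw [← (hasSum_modGeomWeight hb0 hb1 hz).tsum_eq, pgf]
    refine tsum_congr fun m => ?_
    rw [modGeom_apply, ENNReal.toReal_ofReal (modGeomWeight_nonneg hc0 hc1 hb0 hb1 m)]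
  have e : (1 - (1 - b) * z : 𝕜) = 1 - z + z * b := by ring
  rw [h, e]
  simp only [div_eq_mul_inv]
  linear_combination (-c : 𝕜) * mul_inv_cancel₀ hne

lemma norm_pgf_modGeom_sub_lt {𝕜 : Type*} [RCLike 𝕜] {z : 𝕜} (hz : ‖z‖ ≤ 1) (hbc : b ≤ c)
    {δ : ℝ} (hδ : c - b < δ) :
    ‖pgf (modGeom c b hc0 hc1 hb0 hb1) z - b / (1 - z + z * b)‖ <
      δ * ((1 - ‖z‖ + 2 * ‖z‖ * b) / (1 - ‖z‖ + ‖z‖ * b)) := by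
  set t := ‖z‖ with ht
  have ht0 : 0 ≤ t := norm_nonneg z
  have hD : 0 < 1 - t + t * b := by
    rcases hz.eq_or_lt with h | h
    · rw [h]; linarith
    · have : 0 ≤ t * b := by positivity
      linarith
  have hzb : ‖z * (b : 𝕜)‖ = t * b := by
    rw [norm_mul, RCLike.norm_ofReal, abs_of_pos hb0]
  have hd : 1 - t + t * b ≤ ‖(1 - z + z * b : 𝕜)‖ := by
    have h1 : ‖(1 - b : 𝕜) * z‖ = (1 - b) * t := by
      rw [norm_mul, ← RCLike.ofReal_one, ← RCLike.ofReal_sub, RCLike.norm_ofReal,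
        abs_of_nonneg (sub_nonneg.2 hb1)]
    have h2 := norm_sub_norm_le (1 : 𝕜) ((1 - b : 𝕜) * z)
    rw [h1, norm_one] at h2
    have e : (1 - (1 - b) * z : 𝕜) = 1 - z + z * b := by ring
    rw [e] at h2
    linarith
  have hd0 := hD.trans_le hd
  have hn : ‖(1 - z : 𝕜)‖ ≤ ‖(1 - z + z * b : 𝕜)‖ + t * b := by
    have := norm_sub_le (1 - z + z * b : 𝕜) (z * b)
    rwa [add_sub_cancel_right, hzb] at this
  -- From |1 - z| ≤ |1 - z + zb| + |z|b and |1 - z + zb| ≥ 1 - |z| + |z|b.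
  have hratio : ‖(1 - z : 𝕜)‖ / ‖(1 - z + z * b : 𝕜)‖ ≤
      (1 - t + 2 * t * b) / (1 - t + t * b) := by
    have htb : 0 ≤ t * b := by positivity
    calc _ ≤ (‖(1 - z + z * b : 𝕜)‖ + t * b) / ‖(1 - z + z * b : 𝕜)‖ := by gcongr
      _ = 1 + t * b / ‖(1 - z + z * b : 𝕜)‖ := by rw [add_div, div_self hd0.ne']
      _ ≤ 1 + t * b / (1 - t + t * b) := by gcongr
      _ = _ := by
        rw [one_add_div hD.ne']
        congr 1
        ring
  rw [pgf_modGeom_sub hc0 hc1 hb0 hb1 hz (norm_pos_iff.1 hd0), norm_mul, norm_div,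
    ← RCLike.ofReal_sub, RCLike.norm_ofReal, abs_of_nonneg (sub_nonneg.2 hbc)]
  have hpos : 0 < (1 - t + 2 * t * b) / (1 - t + t * b) := by
    refine div_pos ?_ hD
    have : 0 ≤ t * b := by positivity
    linarith
  exact (mul_le_mul_of_nonneg_left hratio (sub_nonneg.2 hbc)).trans_lt
    (mul_lt_mul_of_pos_right hδ hpos)

end

/-! ### The lower bound for the number of losses -/

section

variable [MeasurableSpace Ω] {P : Measure Ω} {lam : ℝ≥0}
  {B : Measure ℝ} {N : ℝ≥0 → Ω → ℕ} {χ : ℕ → Ω → ℝ} {ν γ ς : PMF ℕ} {r : ℝ≥0∞}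

lemma IsMGIInput.measurable_busyState (hM : IsMGIInput P lam B N χ) (n t : ℕ) :
    Measurable fun ω => busyState n (arrivalsDuring N χ ω) t := by
  induction t with
  | zero => exact measurable_const
  | succ t ih =>
    exact (measurable_of_countable fun z : (ℕ × ℕ) × ℕ => serviceStep n z.1 z.2).comp
      (ih.prodMk (hM.measurable_arrivalsDuring t))

/-- Stochastic lower bound for the number of losses, in terms of the law of the number of arrivals
during one service. -/
lemma IsMGIInput.stGE_losses [IsProbabilityMeasure P] [IsProbabilityMeasure B]
    (hM : IsMGIInput P lam B N χ)
    (h0 : B (Iio 0) = 0) (hpos : arrivalLaw lam B {0} ≠ 0) (hr : r ≤ 1)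
    (hν : ∀ f, expect ν f = r * f 0 + (1 - r) * expect γ fun k => f (k + 1))
    (hγ : ∀ f, expect γ f = arrivalLaw lam B {0} * f 0 +
      (1 - arrivalLaw lam B {0}) * expect γ fun k => f (k + 1))
    (hzero : ∀ i, arrivalLaw lam B {i} ≤ r * arrivalLaw lam B (Ici i))
    (htail : ∀ i m, arrivalLaw lam B (Ici i) * ς.toMeasure (Ici m) ≤ arrivalLaw lam B (Ici (i + m)))
    (n : ℕ) : StGE P (losses n N χ) (randomSum (galtonWatson ν n) ς) := by
  intro m
  have huniv : (Ici 0 : Set ℕ) = univ := by ext; simp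
  set f : ℕ → ℝ≥0∞ := (Ici m).indicator 1
  have hf : Monotone f := fun x y h => by
    by_cases hx : m ≤ x
    · simp [f, hx, hx.trans h]
    · simp [f, hx]
  have hf1 : ∀ x, f x ≤ 1 := fun x => indicator_le_self' (by simp) x
  set S : ℕ → Ω → ℕ × ℕ := fun t ω => busyState n (arrivalsDuring N χ ω) t
  have hS : ∀ t, Measurable (S t) := hM.measurable_busyState n
  obtain ⟨θ, hθ⟩ : ∃ θ : ℝ, 2 * θ = (arrivalLaw lam B {0}).toReal :=
    ⟨(arrivalLaw lam B {0}).toReal / 2, by ring⟩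
  have hb0 : 0 < (arrivalLaw lam B {0}).toReal := ENNReal.toReal_pos hpos (measure_ne_top _ _)
  have hb1 : (arrivalLaw lam B {0}).toReal ≤ 1 :=
    ENNReal.toReal_mono ENNReal.one_ne_top prob_le_one
  have hθ0 : 0 < θ := by linarith
  have hθ1 : θ < 1 := by linarith
  set v : ℕ × ℕ → ℝ≥0∞ := fun s => ENNReal.ofReal (1 - θ ^ s.1)
  set ρ := ENNReal.ofReal (1 - θ ^ (n + 1))
  set C := (ENNReal.ofReal (1 - θ))⁻¹
  have hC : C ≠ ∞ := ENNReal.inv_ne_top.2 (ENNReal.ofReal_pos.2 (by linarith)).ne'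
  have hvS : ∀ t, Measurable fun ω => v (S t ω) := fun t => (measurable_of_countable v).comp (hS t)
  have hfS : ∀ t, Measurable fun ω => f (S t ω).2 := fun t =>
    (measurable_of_countable f).comp (hS t).snd
  have hvalue : ∀ t, expect (freshLaw ν γ ς n) f ≤ ∫⁻ ω, value ν γ ς n f (S t ω) ∂P := by
    intro t
    induction t with
    | zero => simp [S, busyState, value, remainingLaw, expect_conv, expect_pure]
    | succ t ih =>
      refine ih.trans ?_
      rw [hM.lintegral_busyState_succ h0]
      exact lintegral_mono fun ω =>
        value_le_tsum hr hν hγ hzero htail hf (busyState_fst_le n _ t)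
  have hlyap : ∀ t, ∫⁻ ω, v (S t ω) ∂P ≤ ρ ^ t := by
    intro t
    induction t with
    | zero => simp [S, v, busyState, hθ0.le]
    | succ t ih =>
      rw [hM.lintegral_busyState_succ h0, pow_succ']
      refine le_trans ?_ (mul_le_mul' le_rfl ih)
      rw [← lintegral_const_mul _ (hvS t)]
      exact lintegral_mono fun ω => tsum_lyapunov_le hθ0.le hθ1.le hθ (busyState_fst_le n _ t)
  -- While customers remain, `value` is at most 1 and C v ≥ 1; in the empty state it is f of the
  -- losses. The error therefore decays like ρ^t.
  have hbound : ∀ s : ℕ × ℕ, value ν γ ς n f s ≤ f s.2 + C * v s := by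
    rintro ⟨q, l⟩
    rcases q with _ | q
    · simp [value, remainingLaw, expect_pure]
    · have h1 : value ν γ ς n f (q + 1, l) ≤ 1 :=
        (expect_mono _ fun x => hf1 _).trans (expect_const _ _).le
      have h2 : 1 ≤ C * v (q + 1, l) := by
        rw [← ENNReal.inv_mul_cancel (ENNReal.ofReal_pos.2 (sub_pos.2 hθ1)).ne'
          ENNReal.ofReal_ne_top]
        refine mul_le_mul' le_rfl (ENNReal.ofReal_le_ofReal ?_)
        have : θ ^ (q + 1) ≤ θ := pow_le_of_le_one hθ0.le hθ1.le (Nat.succ_ne_zero q)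
        simp only
        linarith
      exact h1.trans (h2.trans le_add_self)
  have hloss : ∀ t, ∫⁻ ω, f (S t ω).2 ∂P ≤ P {ω | (m : ℕ∞) ≤ losses n N χ ω} := by
    intro t
    have e : ∀ ω, f (S t ω).2 = {ω | m ≤ (S t ω).2}.indicator 1 ω := fun ω => by
      simp [f, indicator]
    simp_rw [e]
    rw [lintegral_indicator_one (measurableSet_le measurable_const (hS t).snd)]
    refine measure_mono fun ω hω => ?_
    exact (Nat.cast_le.2 hω).trans (le_iSup (fun k =>
      ((busyState n (arrivalsDuring N χ ω) k).2 : ℕ∞)) t)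
  have hfinal : ∀ t, expect (freshLaw ν γ ς n) f ≤
      P {ω | (m : ℕ∞) ≤ losses n N χ ω} + C * ρ ^ t := fun t =>
    calc _ ≤ ∫⁻ ω, (f (S t ω).2 + C * v (S t ω)) ∂P :=
          (hvalue t).trans (lintegral_mono fun ω => hbound _)
      _ = (∫⁻ ω, f (S t ω).2 ∂P) + C * ∫⁻ ω, v (S t ω) ∂P := by
          rw [lintegral_add_left (hfS t),
            lintegral_const_mul _ (hvS t)]
      _ ≤ _ := add_le_add (hloss t) (mul_le_mul' le_rfl (hlyap t))
  have hρ : ρ < 1 := by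
    rw [ENNReal.ofReal_lt_one]
    have := pow_pos hθ0 (n + 1)
    linarith
  have hlim : Tendsto (fun t => P {ω | (m : ℕ∞) ≤ losses n N χ ω} + C * ρ ^ t) atTop
      (𝓝 (P {ω | (m : ℕ∞) ≤ losses n N χ ω})) := by
    have := (ENNReal.Tendsto.const_mul (ENNReal.tendsto_pow_atTop_nhds_zero_of_lt_one hρ)
      (.inr hC)).const_add (P {ω | (m : ℕ∞) ≤ losses n N χ ω})
    simpa using this
  have hbr : arrivalLaw lam B {0} ≤ r := by simpa [huniv] using hzero 0
  rw [toMeasure_Ici, randomSum_galtonWatson]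
  exact (expect_iterate_le_freshLaw hr hbr hν hγ n hf).trans
    (ge_of_tendsto' hlim hfinal)

end

end LossQueue

/-! ### The offspring law and the main theorem. -/

theorem theorem3p4
    (lam : ℝ≥0) (hlam : 0 < lam) (p mu eps : ℝ) (F : Measure ℝ)
    (hB : LossQueue.ConditionB p mu eps F)
    (y₀ : ℝ) (hD : LossQueue.IsLeastResidual lam F y₀) :
    ∃ ν : PMF ℕ,
      -- the bound for the offspring generating function `g`
      (∀ b : ℝ, b = LossQueue.serviceLST lam p mu F →
        (∀ z : ℝ, 0 ≤ z → z ≤ 1 →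
          LossQueue.pgf ν z <
            b / (1 - z + z * b) + 3 * eps * ((1 - z + 2 * z * b) / (1 - z + z * b))) ∧
        (∀ z : ℂ, ‖z‖ ≤ 1 →
          ‖LossQueue.pgf ν z - b / (1 - z + z * b)‖ <
            3 * eps * ((1 - ‖z‖ + 2 * ‖z‖ * b) / (1 - ‖z‖ + ‖z‖ * b)))) ∧
      -- the stochastic lower bound for the number of losses
      (∀ (n : ℕ) (G : Measure ℝ), IsProbabilityMeasure G → G (Iio 0) = 0 →
        LossQueue.CLE lam G (LossQueue.residual F y₀) → LossQueue.CLE lam G (expMeasure mu) →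
        ∀ ς : PMF ℕ,
          (∀ m : ℕ, (ς m).toReal =
            ∫ x, Real.exp (-lam * x) * ((lam * x) ^ m / (m.factorial : ℝ)) ∂G) →
        ∀ (Ω : Type*) [MeasurableSpace Ω] (P : Measure Ω) [IsProbabilityMeasure P]
          (N : ℝ≥0 → Ω → ℕ) (χ : ℕ → Ω → ℝ),
          LossQueue.IsMGIInput P lam (LossQueue.serviceLaw p mu F) N χ →
          LossQueue.StGE P (LossQueue.losses n N χ)
            (LossQueue.randomSum (LossQueue.galtonWatson ν n) ς)) := by
  open LossQueue in
  have hprob := hB.prob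
  have hprobB := isProbabilityMeasure_serviceLaw (F := F) hB.p_pos.le hB.p_le_one hB.mu_pos
  have hb0 := serviceLST_pos hB lam
  have hbr := serviceLST_le_emptyProb hlam hB hD
  have hr1 := emptyProb_le_one hB hD
  have hr0 := hb0.le.trans hbr
  have hδ := emptyProb_sub_serviceLST_lt hlam hB hD
  have hβ0 : arrivalLaw lam (serviceLaw p mu F) {0} = ENNReal.ofReal (serviceLST lam p mu F) := by
    rw [← hB.toReal_arrivalLaw_serviceLaw_zero, ENNReal.ofReal_toReal (measure_ne_top _ _)]
  -- The offspring law has mass `emptyProb` at zero and is geometric with parameter `serviceLST` on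
  -- the positive integers; it depends neither on n nor on G.
  refine ⟨modGeom _ _ hr0 hr1 hb0 (hbr.trans hr1), ?_, ?_⟩
  · rintro b rfl
    refine ⟨fun z hz0 hz1 => ?_, fun z hz => ?_⟩
    · have hz : ‖z‖ = z := Real.norm_of_nonneg hz0
      have h := norm_pgf_modGeom_sub_lt hr0 hr1 hb0 (hbr.trans hr1) (hz.trans_le hz1) hbr hδ
      rw [hz] at h
      have := (le_abs_self _).trans_lt h
      simp only [RCLike.ofReal_real_eq_id, id] at this
      linarith
    · exact norm_pgf_modGeom_sub_lt hr0 hr1 hb0 (hbr.trans hr1) hz hbr hδ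
  · intro n G hG hG0 hGF hGE ς hς Ω _ P _ N χ hM
    have hςG : ς.toMeasure = arrivalLaw lam G := by
      refine Measure.ext_of_singleton fun m => ?_
      rw [PMF.toMeasure_apply_singleton _ _ (measurableSet_singleton m),
        ← ENNReal.toReal_eq_toReal_iff' (ς.apply_ne_top m) (measure_ne_top _ _), hς m,
        toReal_arrivalLaw_singleton lam G hG0]
    refine hM.stGE_losses (measure_mono_null Iio_subset_Iic_self hB.serviceLaw_Iic_zero) ?_
      (ENNReal.ofReal_le_one.2 hr1) (expect_modGeom hr0 hr1 hb0 (hbr.trans hr1)) ?_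
      (arrivalLaw_serviceLaw_singleton_le hlam hB hD) ?_ n
    · rw [hβ0]
      exact (ENNReal.ofReal_pos.2 hb0).ne'
    · rw [hβ0]
      exact expect_modGeom hb0.le (hbr.trans hr1) hb0 (hbr.trans hr1)
    · rw [hςG]
      exact arrivalLaw_serviceLaw_Ici_mul_le hlam hB hD G hGF hGE
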